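/- Let $\underline{C}_2^+=\langle \rho_v,\rho_e,\rho_f \mid \rho_f\rho_e\rho_v=\rho_e^2=1\rangle$ be the oriented cartographic group and let $G_{4,4}=\underline{C}_2^+/\langle\rho_v^4=\rho_f^4=1\rangle$, acting through the integral matrices $$\rho_v=\begin{bmatrix}1&1&2\\0&-1&-2\\0&1&1\end{bmatrix},\quad \rho_e=\begin{bmatrix}-1&0&0\\2&1&2\\0&0&-1\end{bmatrix},\quad \rho_f=\begin{bmatrix}-1&-1&0\\2&1&0\\0&1&1\end{bmatrix}$$ (products in the group being read as matrix products in the opposite order); these are the universal rotation matrices $$\rho_v=\begin{bmatrix}1&1-x&(1-x)(1-y)\\0&-1&-1+y\\0&1+x&-1+(1+x)(1-y)\end{bmatrix},\quad \rho_e=\begin{bmatrix}-1&0&0\\2&1&1-y\\0&0&-1\end{bmatrix},\quad \rho_f=\begin{bmatrix}-1&-1+x&0\\2&1-2x&0\\0&1+x&1\end{bmatrix}$$ of a regular polyhedron, at $x=\cos\theta=0$, $y=\cos\gamma=-1$. Let $n\ge 3$, and let $M_n$ be the regular oriented map (dessin) of the image of $G_{4,4}$ in $GL(3,\mathbb{Z}/n\mathbb{Z})$: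 its oriented flags are the elements of the image, on which $\underline{C}_2^+$ acts by multiplication by the images of $\rho_v,\rho_e,\rho_f$. Put $k=n/2$ if $n$ is even and $k=n$ if $n$ is odd. Then: 1. $M_n$ is isomorphic to the square grid with $k\times k$ squares on a torus, that is, to the tiling of the plane by unit squares with vertices in $\mathbb{Z}[i]$, modulo $k\mathbb{Z}[i]$. 2. The underlying curve of $M_n$ is $\mathbb{C}/\langle 1,i\rangle$: there is a meromorphic function $f$ on this complex torus, ramified at most above $0,1,\infty$, whose dessin (the fibre over $1/2$, with $\rho_v$ and $\rho_e$ acting by the monodromy along counterclockwise loops around $0$ and $1$) is $M_n$. 3. The elliptic curve $y^2=x^3+x$ over $\mathbb{C}$ is biholomorphic to $\mathbb{C}/\langle 1,i\rangle$, with the point at infinity corresponding to $0$, and its $j$-invariant is $1728$. -/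

import Mathlib

open scoped unitInterval

/-! ### Oriented maps and the oriented cartographic group -/

/-- The three generators of the oriented cartographic group. -/
inductive CartGen : Type
  | v
  | e
  | f

/-- The relators `ρ_f ρ_e ρ_v` and `ρ_e ^ 2` of the oriented cartographic group. -/
def cartRelators : Set (FreeGroup CartGen) :=
  {FreeGroup.of CartGen.f * FreeGroup.of CartGen.e * FreeGroup.of CartGen.v,
    FreeGroup.of CartGen.e ^ 2}

/-- The oriented cartographic group `⟨ρ_v, ρ_e, ρ_f | ρ_f ρ_e ρ_v = ρ_e ^ 2 = 1⟩`. -/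
abbrev OrientedCartographicGroup : Type := PresentedGroup cartRelators

/-- A generator `ρ_v`, `ρ_e` or `ρ_f` of the oriented cartographic group. -/
def cartRho (s : CartGen) : OrientedCartographicGroup := PresentedGroup.of s

theorem cartRho_rel : cartRho .f * cartRho .e * cartRho .v = 1 := by
  have h := PresentedGroup.one_of_mem (rels := cartRelators)
    (x := FreeGroup.of CartGen.f * FreeGroup.of CartGen.e * FreeGroup.of CartGen.v)
    (by simp [cartRelators])
  rw [map_mul, map_mul] at h
  exact h

theorem cartRho_e_sq : cartRho .e ^ 2 = 1 := by
  have h := PresentedGroup.one_of_mem (rels := cartRelators)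
    (x := FreeGroup.of CartGen.e ^ 2) (by simp [cartRelators])
  rw [map_pow] at h
  exact h

/-- The group `G_{p,q}`: the quotient of the oriented cartographic group by the relations
`ρ_v ^ p = ρ_f ^ q = 1`. -/
abbrev TilingGroup (p q : ℕ) : Type :=
  OrientedCartographicGroup ⧸ Subgroup.normalClosure {cartRho .v ^ p, cartRho .f ^ q}

/-- An oriented map (the combinatorial data of a dessin): a set of oriented flags with the
counterclockwise rotations `ρ_v`, `ρ_e`, `ρ_f` of a flag about its vertex, its edge midpoint and
its face centre.  Permutations are multiplied as functions, so that in `ρ_f * ρ_e * ρ_v` the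
rotation `ρ_v` is applied first. -/
structure OrientedMap where
  Flag : Type
  rhoV : Equiv.Perm Flag
  rhoE : Equiv.Perm Flag
  rhoF : Equiv.Perm Flag
  rel : rhoF * rhoE * rhoV = 1
  rhoE_sq : rhoE ^ 2 = 1

/-- An isomorphism of oriented maps: a bijection of the oriented flags that commutes with the
three rotations. -/
structure OrientedMap.Iso (M N : OrientedMap) where
  toEquiv : M.Flag ≃ N.Flag
  map_rhoV : ∀ d, toEquiv (M.rhoV d) = N.rhoV (toEquiv d)
  map_rhoE : ∀ d, toEquiv (M.rhoE d) = N.rhoE (toEquiv d)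
  map_rhoF : ∀ d, toEquiv (M.rhoF d) = N.rhoF (toEquiv d)

/-- The regular oriented map of a quotient of the oriented cartographic group, the quotient being
given as the image of a homomorphism `φ`: its oriented flags are the elements of the image, and
the oriented cartographic group acts on them by left multiplication. -/
def OrientedMap.ofHom {H : Type} [Group H] (φ : OrientedCartographicGroup →* H) :
    OrientedMap where
  Flag := φ.range
  rhoV := MulAction.toPermHom φ.range φ.range (φ.rangeRestrict (cartRho .v))
  rhoE := MulAction.toPermHom φ.range φ.range (φ.rangeRestrict (cartRho .e))
  rhoF := MulAction.toPermHom φ.range φ.range (φ.rangeRestrict (cartRho .f))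
  rel := by rw [← map_mul, ← map_mul, ← map_mul, ← map_mul, cartRho_rel, map_one, map_one]
  rhoE_sq := by rw [← map_pow, ← map_pow, cartRho_e_sq, map_one, map_one]

/-! ### The universal regular polyhedron -/

section Universal

variable {R : Type} [CommRing R]

/-- The matrix of `ρ_v` with parameters `x = cos θ` and `y = cos γ`. -/
def matV (x y : R) : Matrix (Fin 3) (Fin 3) R :=
  !![1, 1 - x, (1 - x) * (1 - y);
     0, -1, -1 + y;
     0, 1 + x, -1 + (1 + x) * (1 - y)]

/-- The matrix of `ρ_e` with parameters `x = cos θ` and `y = cos γ`. -/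
def matE (_x y : R) : Matrix (Fin 3) (Fin 3) R :=
  !![-1, 0, 0;
     2, 1, 1 - y;
     0, 0, -1]

/-- The matrix of `ρ_f` with parameters `x = cos θ` and `y = cos γ`. -/
def matF (x _y : R) : Matrix (Fin 3) (Fin 3) R :=
  !![-1, -1 + x, 0;
     2, 1 - 2 * x, 0;
     0, 1 + x, 1]

theorem matV_mul_matE_mul_matF (x y : R) : matV x y * matE x y * matF x y = 1 := by
  ext i j
  fin_cases i <;> fin_cases j <;>
    simp [matV, matE, matF, Matrix.mul_apply, Fin.sum_univ_three] <;> ring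

theorem matE_sq (x y : R) : matE x y ^ 2 = 1 := by
  ext i j
  fin_cases i <;> fin_cases j <;>
    simp [matE, pow_two, Matrix.mul_apply, Fin.sum_univ_three]

theorem isUnit_matE (x y : R) : IsUnit (matE x y) :=
  IsUnit.of_mul_eq_one (matE x y) (by rw [← pow_two, matE_sq])

theorem isUnit_matV (x y : R) : IsUnit (matV x y) :=
  IsUnit.of_mul_eq_one (matE x y * matF x y) (by rw [← mul_assoc, matV_mul_matE_mul_matF])

theorem isUnit_matF (x y : R) : IsUnit (matF x y) := by
  have h : matV x y * matE x y * matF x y = 1 := matV_mul_matE_mul_matF x y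
  exact IsUnit.of_mul_eq_one (matV x y * matE x y) (mul_eq_one_comm.mp h)

/-- The rotations of the regular polyhedron over `R` with parameters `x`, `y`, in `GL(3, R)`. -/
noncomputable def polyRho (x y : R) : CartGen → GL (Fin 3) R
  | .v => (isUnit_matV x y).unit
  | .e => (isUnit_matE x y).unit
  | .f => (isUnit_matF x y).unit

theorem polyRho_rel (x y : R) : polyRho x y .v * polyRho x y .e * polyRho x y .f = 1 :=
  Units.ext (matV_mul_matE_mul_matF x y)

theorem polyRho_e_sq (x y : R) : polyRho x y .e ^ 2 = 1 :=
  Units.ext (matE_sq x y)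

/-- The regular polyhedron over `R` with parameters `x = cos θ`, `y = cos γ`, as a homomorphism
from the oriented cartographic group to `GL(3, R)`.  The matrices satisfy
`matV * matE * matF = 1`, that is, the relation `ρ_f ρ_e ρ_v = 1` with products of matrices read
in the opposite order; hence the opposite group.  Equivalently: on a flag `g • base`, with `g` in
the rotation group of the polyhedron, the rotation of the flag about its own vertex is right
multiplication of `g` by the matrix of `ρ_v`. -/
noncomputable def universalPolyhedron (x y : R) :
    OrientedCartographicGroup →* (GL (Fin 3) R)ᵐᵒᵖ :=
  PresentedGroup.toGroup (f := fun s => MulOpposite.op (polyRho x y s)) (by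
    intro r hr
    rcases hr with rfl | rfl
    · simp only [map_mul, FreeGroup.lift_apply_of]
      rw [← MulOpposite.op_mul, ← MulOpposite.op_mul, ← mul_assoc, polyRho_rel]
      rfl
    · simp only [map_pow, FreeGroup.lift_apply_of]
      rw [← MulOpposite.op_pow, polyRho_e_sq]
      rfl)

end Universal

theorem universalPolyhedron_cartRho {R : Type} [CommRing R] (x y : R) (s : CartGen) :
    universalPolyhedron x y (cartRho s) = MulOpposite.op (polyRho x y s) :=
  PresentedGroup.toGroup.of _

theorem matV_pow_four : matV (0 : ℤ) (-1) ^ 4 = 1 := by decide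

theorem matF_pow_four : matF (0 : ℤ) (-1) ^ 4 = 1 := by decide

/-- The realization of `G_{4,4}` by integral matrices, with `cos θ = 0` and `cos γ = -1`. -/
noncomputable def squareTiling : TilingGroup 4 4 →* (GL (Fin 3) ℤ)ᵐᵒᵖ :=
  QuotientGroup.lift _ (universalPolyhedron (0 : ℤ) (-1)) (by
    apply Subgroup.normalClosure_le_normal
    rintro _ (rfl | rfl)
    · change universalPolyhedron (0 : ℤ) (-1) (cartRho .v ^ 4) = 1
      rw [map_pow, universalPolyhedron_cartRho, ← MulOpposite.op_pow]
      exact congrArg MulOpposite.op (Units.ext matV_pow_four)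
    · change universalPolyhedron (0 : ℤ) (-1) (cartRho .f ^ 4) = 1
      rw [map_pow, universalPolyhedron_cartRho, ← MulOpposite.op_pow]
      exact congrArg MulOpposite.op (Units.ext matF_pow_four))

/-- The reduction modulo `n` of `G_{4,4}`, with values in `GL(3, ℤ/nℤ)`. -/
noncomputable def squareTilingMod (n : ℕ) : TilingGroup 4 4 →* (GL (Fin 3) (ZMod n))ᵐᵒᵖ :=
  (MonoidHom.op (Matrix.GeneralLinearGroup.map (Int.castRingHom (ZMod n)))).comp squareTiling

/-- The regular oriented map of the image of `G_{4,4}` in `GL(3, ℤ/nℤ)`. -/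
noncomputable def squareTilingMap (n : ℕ) : OrientedMap :=
  OrientedMap.ofHom ((squareTilingMod n).comp (QuotientGroup.mk' _))

/-! ### The square grid on a torus -/

/-- The imaginary unit of `ℤ[i]`, as a unit. -/
def gaussianI : GaussianIntˣ where
  val := ⟨0, 1⟩
  inv := ⟨0, -1⟩
  val_inv := by decide
  inv_val := by decide

/-- The `k × k` square grid on the torus, that is, the tiling of the plane by the unit squares with
vertices in `ℤ[i]`, modulo `kℤ[i]`.  An oriented flag is an oriented edge, given by its initial
vertex `P` in `ℤ[i]/kℤ[i]` and its direction `d`, one of `1, i, -1, -i`; the face of the flag is the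
square to the left of the edge. -/
def squareGrid (k : ℕ) : OrientedMap where
  Flag := (GaussianInt ⧸ Ideal.span {(k : GaussianInt)}) × GaussianIntˣ
  rhoV :=
    { toFun := fun a => (a.1, gaussianI * a.2)
      invFun := fun a => (a.1, gaussianI⁻¹ * a.2)
      left_inv := fun a => by simp
      right_inv := fun a => by simp }
  rhoE :=
    { toFun := fun a => (a.1 + Ideal.Quotient.mk _ (a.2 : GaussianInt), -a.2)
      invFun := fun a => (a.1 + Ideal.Quotient.mk _ (a.2 : GaussianInt), -a.2)
      left_inv := fun a => by simp
      right_inv := fun a => by simp }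
  rhoF :=
    { toFun := fun a => (a.1 + Ideal.Quotient.mk _ (a.2 : GaussianInt), gaussianI * a.2)
      invFun := fun a =>
        (a.1 - Ideal.Quotient.mk _ ((gaussianI⁻¹ * a.2 : GaussianIntˣ) : GaussianInt),
          gaussianI⁻¹ * a.2)
      left_inv := fun a => by simp
      right_inv := fun a => by simp }
  rel := by
    have hI : gaussianI * gaussianI = -1 := by decide
    ext1 a
    simp [← mul_assoc, hI]
  rhoE_sq := by
    ext1 a
    simp [pow_two]

/-! ### Complex tori, Belyi functions and Weierstrass curves -/

/-- The lattice `⟨1, i⟩` in `ℂ`. -/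
def gaussianLattice : Submodule ℤ ℂ := Submodule.span ℤ {1, Complex.I}

/-- `f` is a Belyi function on the complex torus `ℂ/Λ`: a nonconstant meromorphic function that is
ramified at most above `0`, `1`, `∞`.  At its poles `f` takes the default value `0` (this is the
normal form of a meromorphic function), so that `f` is holomorphic at each point where it does not
vanish. -/
structure IsBelyiFunction (Λ : Submodule ℤ ℂ) (f : ℂ ⧸ Λ → ℂ) : Prop where
  meromorphic : MeromorphicNFOn (fun z : ℂ => f (Submodule.Quotient.mk z)) Set.univ
  nonconstant : ∃ P Q, f P ≠ f Q
  unramified : ∀ z : ℂ, f (Submodule.Quotient.mk z) ≠ 0 → f (Submodule.Quotient.mk z) ≠ 1 →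
    deriv (fun w : ℂ => f (Submodule.Quotient.mk w)) z ≠ 0

/-- The loop at `1/2` that runs once counterclockwise around `0`. -/
noncomputable def loopZero (t : I) : ℂ :=
  1 / 2 * Complex.exp (2 * Real.pi * Complex.I * ((t : ℝ) : ℂ))

/-- The loop at `1/2` that runs once counterclockwise around `1`. -/
noncomputable def loopOne (t : I) : ℂ :=
  1 - 1 / 2 * Complex.exp (2 * Real.pi * Complex.I * ((t : ℝ) : ℂ))

/-- The oriented map `M` is the dessin of the Belyi function `f` on `ℂ/Λ`, whose vertices are the
zeros of `f`, whose edge midpoints are the points with `f = 1` and whose face centres are the poles.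
The oriented flags correspond to the points of the fibre over `1/2` (one on each segment of the
preimage of `(0, 1)`, which joins a vertex to an edge midpoint), and `ρ_v` and `ρ_e` to the
monodromy along the loops around `0` and around `1`; then `ρ_f` is the monodromy around `∞`. -/
def OrientedMap.IsDessinOf (M : OrientedMap) {Λ : Submodule ℤ ℂ} (f : ℂ ⧸ Λ → ℂ) : Prop :=
  ∃ φ : M.Flag ≃ {P : ℂ ⧸ Λ // f P = 1 / 2},
    (∀ d, ∃ γ : Path (φ d : ℂ ⧸ Λ) (φ (M.rhoV d)), ∀ t, f (γ t) = loopZero t) ∧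
    (∀ d, ∃ γ : Path (φ d : ℂ ⧸ Λ) (φ (M.rhoE d)), ∀ t, f (γ t) = loopOne t)

/-- The complex points of the Weierstrass curve `W` form the complex torus `ℂ/Λ`: there is a
biholomorphic map from `ℂ/Λ` to `W` that sends `0` to the point at infinity.  In terms of the affine
coordinates `x`, `y` of the image of `z`: these are holomorphic off `Λ`, and at the points of `Λ`
they have poles of orders `2` and `3`, that is, `x / y` is a local coordinate there, as it is on `W`
at infinity.  (Such a map is automatically an isomorphism of groups.) -/
def IsComplexTorus (W : WeierstrassCurve ℂ) (Λ : Submodule ℤ ℂ) : Prop :=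
  ∃ (φ : (ℂ ⧸ Λ) ≃ W.toAffine.Point) (x y : ℂ → ℂ),
    φ 0 = WeierstrassCurve.Affine.Point.zero ∧
    (∀ z ∉ Λ, ∃ h : W.toAffine.Nonsingular (x z) (y z),
      φ (Submodule.Quotient.mk z) = WeierstrassCurve.Affine.Point.some (x z) (y z) h) ∧
    (∀ z ∉ Λ, AnalyticAt ℂ x z ∧ AnalyticAt ℂ y z) ∧
    (∀ z ∈ Λ, meromorphicOrderAt x z = -2 ∧ meromorphicOrderAt y z = -3)

/-- The curve `y ^ 2 = x ^ 3 + x` over `ℂ`. -/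
def curveE : WeierstrassCurve ℂ where
  a₁ := 0
  a₂ := 0
  a₃ := 0
  a₄ := 1
  a₆ := 0

instance : curveE.IsElliptic where
  isUnit := by
    rw [isUnit_iff_ne_zero]
    norm_num [curveE, WeierstrassCurve.Δ, WeierstrassCurve.b₂, WeierstrassCurve.b₄,
      WeierstrassCurve.b₆, WeierstrassCurve.b₈]

/-! ### The matrices of the flags of the square grid -/

/-! Part 1. At cos θ = 0, cos γ = -1 the column sums of the matrices are 1: they are affine maps of
the plane, in barycentric coordinates with respect to the vertex 0, the edge midpoint 1/2 and the
face centre (1+i)/2 of the base flag. The group consists of the maps z ↦ P + dz with P in ℤ[i] and d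
a unit, and `flagMatrix` is the matrix of this map. As the reference points are half a unit apart, P
enters only through 2P. So the reduction modulo n sees P modulo k, and it separates the four
directions because n ≥ 3 (`flagMatrix_eq_iff`).

Part 2. Write ℘ for the Weierstrass function of ⟨1, i⟩ and e = ℘(1/2). Multiplication by i preserves
the lattice, so ℘(iz) = -℘(z), g₃ = 0 and ℘'² = 4℘(℘² - e²). The function B = e²/℘² is then
invariant under translations by ℤ[i] and under the four rotations. Its fibre over 1/2 is a single
free orbit modulo the lattice (`unit_eq_of_sub_mul_mem`, `exists_unit_sub_mul_mem`). The Belyi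
function for the k × k grid is z ↦ B(kz), and the flag (P, d) goes to (P + d t₀)/k for one point t₀
with B(t₀) = 1/2. By symmetry the monodromy need only be computed at t₀.

That computation rests on the equation B'⁴ = 256 e² B³ (1 - B)² (`deriv_gaussianB_pow_four`). It
integrates to two explicit uniformizations of B on the unit disc: B(A(s)) = s⁴ at a vertex and B(1/2
- D(u)) = 1 - u² at an edge midpoint. A quarter turn of s lifts the loop around 0 and takes t₀ to i
t₀; a half turn of u lifts the loop around 1 and takes t₀ to 1 - t₀ (`exists_gaussianB_monodromy`).
That both discs see the same t₀ is checked on the real axis.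

Part 3. Suitable multiples of ℘ and ℘' satisfy y² = x³ + x. Injectivity on the torus is uniqueness
for the differential equation of (℘, ℘') (`PeriodPair.sub_mem_lattice_of_eq_of_eq`); surjectivity is
Liouville's theorem (`PeriodPair.exists_weierstrassP_eq`). -/

/-- The `k` such that the reduction modulo `n` of the square tiling is the `k × k` square grid. -/
def gridSize (n : ℕ) : ℕ := if Even n then n / 2 else n

/-- A factor 2 cancels against an even n and is invertible modulo an odd n. This is where the two
cases for the grid size come from. -/
theorem gridSize_dvd_iff (n : ℕ) (a : ℤ) :
    (gridSize n : ℤ) ∣ a ↔ ((2 * a : ℤ) : ZMod n) = 0 := by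
  rw [ZMod.intCast_zmod_eq_zero_iff_dvd, gridSize]
  split_ifs with h
  · obtain ⟨m, rfl⟩ := h
    rw [← two_mul, Nat.mul_div_cancel_left _ two_pos]
    push_cast
    rw [mul_dvd_mul_iff_left two_ne_zero]
  · have : IsCoprime (n : ℤ) 2 := by
      rw [Int.isCoprime_iff_gcd_eq_one]
      exact Nat.coprime_two_right.mpr (Nat.not_even_iff_odd.mp h)
    exact ⟨fun h => h.mul_left 2, fun h => this.dvd_of_dvd_mul_left h⟩

/-- The matrix modulo `n` of the rotation of the square tiling that takes the flag at `0` in the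
direction `1` to the flag at `P` in the direction `d`. -/
def flagMatrix (n : ℕ) (P d : GaussianInt) : Matrix (Fin 3) (Fin 3) (ZMod n) :=
  let a : ZMod n := P.re
  let b : ZMod n := P.im
  let x : ZMod n := d.re
  let y : ZMod n := d.im
  -- The columns are the barycentric coordinates of P, P + d/2 and P + d(1+i)/2 with respect to the
  -- points 0, 1/2, (1+i)/2.
  !![1 - 2 * a, 1 - x - 2 * a, 1 - x + y - 2 * a;
     2 * a - 2 * b, x - y + 2 * a - 2 * b, -2 * y + 2 * a - 2 * b;
     2 * b, y + 2 * b, x + y + 2 * b]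

theorem flagMatrix_zero_one (n : ℕ) : flagMatrix n 0 1 = 1 := by
  ext i j
  fin_cases i <;> fin_cases j <;> simp [flagMatrix]

/-- `matV` is the matrix of z ↦ iz, and precomposing z ↦ P + dz with it multiplies d by i. In the
same way `matE` is z ↦ 1 - z, which gives (P + d, -d). -/
theorem flagMatrix_mul_matV (n : ℕ) (P d : GaussianInt) :
    flagMatrix n P d * matV 0 (-1) = flagMatrix n P (gaussianI * d) := by
  ext i j
  fin_cases i <;> fin_cases j <;>
    simp [flagMatrix, matV, gaussianI, Matrix.mul_apply, Fin.sum_univ_three] <;> ring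

theorem flagMatrix_mul_matE (n : ℕ) (P d : GaussianInt) :
    flagMatrix n P d * matE 0 (-1) = flagMatrix n (P + d) (-d) := by
  ext i j
  fin_cases i <;> fin_cases j <;>
    simp [flagMatrix, matE, Matrix.mul_apply, Fin.sum_univ_three] <;> ring

theorem mk_gridSize_eq_iff (n : ℕ) (P Q : GaussianInt) :
    (Ideal.Quotient.mk (Ideal.span {(gridSize n : GaussianInt)}) P = Ideal.Quotient.mk _ Q) ↔
      2 * (P.re : ZMod n) = 2 * (Q.re : ZMod n) ∧ 2 * (P.im : ZMod n) = 2 * (Q.im : ZMod n) := by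
  rw [Ideal.Quotient.eq, Ideal.mem_span_singleton]
  have : ((gridSize n : ℕ) : GaussianInt) = (((gridSize n : ℕ) : ℤ) : GaussianInt) := by simp
  rw [this, Zsqrtd.intCast_dvd, gridSize_dvd_iff, gridSize_dvd_iff]
  push_cast [Zsqrtd.re_sub, Zsqrtd.im_sub]
  rw [mul_sub, mul_sub, sub_eq_zero, sub_eq_zero]

theorem gaussianUnit_cases (d : GaussianIntˣ) :
    (d : GaussianInt) = 1 ∨ (d : GaussianInt) = ⟨0, 1⟩ ∨ (d : GaussianInt) = -1 ∨
      (d : GaussianInt) = ⟨0, -1⟩ := by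
  have h : (d : GaussianInt).norm.natAbs = 1 := Zsqrtd.norm_eq_one_iff.mpr d.isUnit
  have h0 : 0 ≤ (d : GaussianInt).norm := GaussianInt.norm_nonneg _
  have h1 : (d : GaussianInt).re * (d : GaussianInt).re +
      (d : GaussianInt).im * (d : GaussianInt).im = 1 := by
    have : (d : GaussianInt).norm = 1 := by omega
    rw [Zsqrtd.norm_def] at this
    linarith
  clear h h0
  generalize (d : GaussianInt) = p at h1 ⊢
  obtain ⟨x, y⟩ := p
  change x * x + y * y = 1 at h1
  have hx : -1 ≤ x ∧ x ≤ 1 := ⟨by nlinarith, by nlinarith⟩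
  have hy : -1 ≤ y ∧ y ≤ 1 := ⟨by nlinarith, by nlinarith⟩
  obtain ⟨hx1, hx2⟩ := hx
  obtain ⟨hy1, hy2⟩ := hy
  interval_cases x <;> interval_cases y <;> simp_all [Zsqrtd.ext_iff]

/-- Differences of entries within a row recover d modulo n, and the first column recovers 2P. The
coordinates of two units differ by at most 2 in absolute value, so n ≥ 3 turns the congruence of
directions into equality. -/
theorem flagMatrix_eq_iff {n : ℕ} (hn : 3 ≤ n) (P Q : GaussianInt) (c d : GaussianIntˣ) :
    flagMatrix n P c = flagMatrix n Q d ↔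
      (Ideal.Quotient.mk (Ideal.span {(gridSize n : GaussianInt)}) P = Ideal.Quotient.mk _ Q) ∧
        c = d := by
  rw [mk_gridSize_eq_iff]
  constructor
  · intro h
    have e00 := congrFun (congrFun h 0) 0
    have e01 := congrFun (congrFun h 0) 1
    have e20 := congrFun (congrFun h 2) 0
    have e21 := congrFun (congrFun h 2) 1
    simp only [flagMatrix, Matrix.of_apply, Matrix.cons_val', Matrix.cons_val_zero,
      Matrix.cons_val_one, Matrix.cons_val] at e00 e01 e20 e21
    have hx : (((c : GaussianInt).re - (d : GaussianInt).re : ℤ) : ZMod n) = 0 := by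
      push_cast
      linear_combination e00 - e01
    have hy : (((c : GaussianInt).im - (d : GaussianInt).im : ℤ) : ZMod n) = 0 := by
      push_cast
      linear_combination e21 - e20
    refine ⟨⟨by linear_combination -e00, e20⟩, ?_⟩
    rw [ZMod.intCast_zmod_eq_zero_iff_dvd] at hx hy
    obtain ⟨r, hr⟩ := hx
    obtain ⟨s, hs⟩ := hy
    have hn' : (3 : ℤ) ≤ n := by exact_mod_cast hn
    have small : ∀ t u : ℤ, -2 ≤ t → t ≤ 2 → t = n * u → t = 0 := by
      intro t u h1 h2 h3
      rcases lt_trichotomy u 0 with hu | hu | hu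
      · nlinarith
      · simp [h3, hu]
      · nlinarith
    ext
    · have := small _ r ?_ ?_ hr
      · omega
      all_goals
        rcases gaussianUnit_cases c with h1 | h1 | h1 | h1 <;>
        rcases gaussianUnit_cases d with h2 | h2 | h2 | h2 <;> simp [h1, h2]
    · have := small _ s ?_ ?_ hs
      · omega
      all_goals
        rcases gaussianUnit_cases c with h1 | h1 | h1 | h1 <;>
        rcases gaussianUnit_cases d with h2 | h2 | h2 | h2 <;> simp [h1, h2]
  · rintro ⟨⟨h1, h2⟩, rfl⟩
    simp only [flagMatrix, h1, h2]

/-! ### The reduction of the square tiling -/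

/-- The image of an element of the cartographic group in `GL(3, ℤ/nℤ)`, as a matrix. -/
noncomputable def cartMatrix (n : ℕ) (g : OrientedCartographicGroup) :
    Matrix (Fin 3) (Fin 3) (ZMod n) :=
  ((squareTilingMod n).comp (QuotientGroup.mk' _) g).unop

theorem cartMatrix_mul (n : ℕ) (g h : OrientedCartographicGroup) :
    cartMatrix n (g * h) = cartMatrix n h * cartMatrix n g := by
  simp [cartMatrix]

theorem cartMatrix_one (n : ℕ) : cartMatrix n 1 = 1 := by
  simp [cartMatrix]

theorem cartMatrix_eq_map (n : ℕ) (g : OrientedCartographicGroup) :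
    cartMatrix n g =
      ((universalPolyhedron (0 : ℤ) (-1) g).unop : Matrix _ _ ℤ).map (Int.castRingHom (ZMod n)) :=
  rfl

theorem cartMatrix_v (n : ℕ) : cartMatrix n (cartRho .v) = matV 0 (-1) := by
  rw [cartMatrix_eq_map, universalPolyhedron_cartRho]
  change (matV (0 : ℤ) (-1)).map _ = _
  ext i j
  fin_cases i <;> fin_cases j <;> simp [matV] <;> norm_num

theorem cartMatrix_e (n : ℕ) : cartMatrix n (cartRho .e) = matE 0 (-1) := by
  rw [cartMatrix_eq_map, universalPolyhedron_cartRho]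
  change (matE (0 : ℤ) (-1)).map _ = _
  ext i j
  fin_cases i <;> fin_cases j <;> (simp [matE]; try norm_num)

/-- The relation `ρ_f ρ_e ρ_v = 1` makes `ρ_f` redundant as a generator. -/
theorem OrientedCartographicGroup.induction {p : OrientedCartographicGroup → Prop}
    (one : p 1) (v : p (cartRho .v)) (e : p (cartRho .e))
    (mul : ∀ g h, p g → p h → p (g * h)) (inv : ∀ g, p g → p g⁻¹)
    (g : OrientedCartographicGroup) : p g := by
  have f : p (cartRho .f) := by
    have : cartRho .f = (cartRho .v)⁻¹ * (cartRho .e)⁻¹ := by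
      rw [← mul_inv_rev, eq_inv_iff_mul_eq_one, ← mul_assoc, cartRho_rel]
    rw [this]
    exact mul _ _ (inv _ v) (inv _ e)
  have gen : ∀ s, p (cartRho s) := by rintro (_ | _ | _) <;> assumption
  induction g using PresentedGroup.induction_on with
  | _ w =>
    induction w using FreeGroup.induction_on with
    | C1 => simpa using one
    | of s => exact gen s
    | inv_of s _ => rw [map_inv]; exact inv _ (gen s)
    | mul x y hx hy => rw [map_mul]; exact mul _ _ hx hy

/-- The matrix modulo `n` of a flag of the square grid. -/
noncomputable def gridMatrix (n : ℕ) (a : (squareGrid (gridSize n)).Flag) :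
    Matrix (Fin 3) (Fin 3) (ZMod n) :=
  flagMatrix n (Quotient.out a.1) a.2

theorem gridMatrix_mk {n : ℕ} (hn : 3 ≤ n) (P : GaussianInt) (d : GaussianIntˣ) :
    gridMatrix n (Ideal.Quotient.mk _ P, d) = flagMatrix n P d := by
  refine (flagMatrix_eq_iff hn _ _ _ _).mpr ?_
  exact ⟨Quotient.out_eq _, rfl⟩

theorem gridFlag_surj {k : ℕ} (a : (squareGrid k).Flag) :
    ∃ (P : GaussianInt) (d : GaussianIntˣ), a = (Ideal.Quotient.mk _ P, d) := by
  obtain ⟨p, d⟩ := a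
  obtain ⟨P, rfl⟩ := Ideal.Quotient.mk_surjective p
  exact ⟨P, d, rfl⟩

theorem gridMatrix_injective {n : ℕ} (hn : 3 ≤ n) : Function.Injective (gridMatrix n) := by
  intro a b h
  obtain ⟨P, c, rfl⟩ := gridFlag_surj a
  obtain ⟨Q, d, rfl⟩ := gridFlag_surj b
  rw [gridMatrix_mk hn, gridMatrix_mk hn, flagMatrix_eq_iff hn] at h
  exact Prod.ext h.1 h.2

theorem gridMatrix_rhoV {n : ℕ} (hn : 3 ≤ n) (a : (squareGrid (gridSize n)).Flag) :
    gridMatrix n ((squareGrid (gridSize n)).rhoV a) = gridMatrix n a * matV 0 (-1) := by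
  obtain ⟨P, d, rfl⟩ := gridFlag_surj a
  rw [gridMatrix_mk hn, flagMatrix_mul_matV]
  exact gridMatrix_mk hn P (gaussianI * d)

theorem gridMatrix_rhoE {n : ℕ} (hn : 3 ≤ n) (a : (squareGrid (gridSize n)).Flag) :
    gridMatrix n ((squareGrid (gridSize n)).rhoE a) = gridMatrix n a * matE 0 (-1) := by
  obtain ⟨P, d, rfl⟩ := gridFlag_surj a
  rw [gridMatrix_mk hn, flagMatrix_mul_matE]
  exact gridMatrix_mk hn (P + d) (-d)

/-- Asking for a permutation rather than a mere map of the flags lets the induction pass to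
inverses. -/
theorem exists_gridMatrix_eq_mul_cartMatrix {n : ℕ} (hn : 3 ≤ n) (g : OrientedCartographicGroup) :
    ∃ p : Equiv.Perm (squareGrid (gridSize n)).Flag,
      ∀ a, gridMatrix n (p a) = gridMatrix n a * cartMatrix n g := by
  induction g using OrientedCartographicGroup.induction with
  | one => exact ⟨1, fun a => by simp [cartMatrix_one]⟩
  | v => exact ⟨_, fun a => by rw [gridMatrix_rhoV hn, cartMatrix_v]⟩
  | e => exact ⟨_, fun a => by rw [gridMatrix_rhoE hn, cartMatrix_e]⟩
  | mul g h hg hh =>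
    obtain ⟨p, hp⟩ := hg
    obtain ⟨q, hq⟩ := hh
    exact ⟨p * q, fun a => by rw [Equiv.Perm.mul_apply, hp, hq, cartMatrix_mul, mul_assoc]⟩
  | inv g hg =>
    obtain ⟨p, hp⟩ := hg
    refine ⟨p⁻¹, fun a => ?_⟩
    have := hp (p⁻¹ a)
    rw [← Equiv.Perm.mul_apply, mul_inv_cancel, Equiv.Perm.one_apply] at this
    rw [this, mul_assoc, ← cartMatrix_mul, inv_mul_cancel, cartMatrix_one, mul_one]

/-- The grid is connected: `ρ_v` turns a flag about its vertex and `ρ_e` carries it across an edge,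
so every flag can be reached from the base flag. -/
theorem gridMatrix_mem_range {n : ℕ} (hn : 3 ≤ n) (a : (squareGrid (gridSize n)).Flag) :
    ∃ g, cartMatrix n g = gridMatrix n a := by
  have hV : ∀ (P : GaussianInt) (d : GaussianIntˣ), (∃ g, cartMatrix n g = flagMatrix n P d) →
      ∃ g, cartMatrix n g = flagMatrix n P ((gaussianI * d : GaussianIntˣ) : GaussianInt) := by
    rintro P d ⟨g, hg⟩
    exact ⟨cartRho .v * g, by
      rw [cartMatrix_mul, cartMatrix_v, hg, flagMatrix_mul_matV, Units.val_mul]⟩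
  have hE : ∀ (P : GaussianInt) (d : GaussianIntˣ), (∃ g, cartMatrix n g = flagMatrix n P d) →
      ∃ g, cartMatrix n g = flagMatrix n (P + d) ((-d : GaussianIntˣ) : GaussianInt) := by
    rintro P d ⟨g, hg⟩
    exact ⟨cartRho .e * g, by
      rw [cartMatrix_mul, cartMatrix_e, hg, flagMatrix_mul_matE, Units.val_neg]⟩
  have rot : ∀ (P : GaussianInt), (∃ g, cartMatrix n g = flagMatrix n P 1) →
      ∀ d : GaussianIntˣ, ∃ g, cartMatrix n g = flagMatrix n P d := by
    intro P h0 d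
    have h1 := hV P 1 h0
    have h2 := hV P _ h1
    have h3 := hV P _ h2
    rcases gaussianUnit_cases d with h | h | h | h
    · rw [h]; exact h0
    · rw [h]; exact h1
    · rw [h]; exact h2
    · rw [h]; exact h3
  have step : ∀ (P : GaussianInt), (∃ g, cartMatrix n g = flagMatrix n P 1) →
      ∀ d : GaussianIntˣ, ∃ g, cartMatrix n g = flagMatrix n (P + d) 1 := by
    intro P h0 d
    -- Crossing the edge leaves the flag pointing back along -d; further turns by i restore the
    -- direction 1.
    have h1 := hE P d (rot P h0 d)
    rcases gaussianUnit_cases d with h | h | h | h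
    · have e : (((gaussianI * (gaussianI * -d) : GaussianIntˣ)) : GaussianInt) = 1 := by
        rw [Units.val_mul, Units.val_mul, Units.val_neg, h]; rfl
      rw [← e]
      exact hV _ _ (hV _ _ h1)
    · have e : (((gaussianI * -d : GaussianIntˣ)) : GaussianInt) = 1 := by
        rw [Units.val_mul, Units.val_neg, h]; rfl
      rw [← e]
      exact hV _ _ h1
    · have e : ((-d : GaussianIntˣ) : GaussianInt) = 1 := by
        rw [Units.val_neg, h, neg_neg]
      rw [← e]
      exact h1
    · have e : (((gaussianI * (gaussianI * (gaussianI * -d)) : GaussianIntˣ)) : GaussianInt) =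
          1 := by
        rw [Units.val_mul, Units.val_mul, Units.val_mul, Units.val_neg, h]; rfl
      rw [← e]
      exact hV _ _ (hV _ _ (hV _ _ h1))
  have re : ∀ x : ℤ, ∃ g, cartMatrix n g = flagMatrix n ⟨x, 0⟩ 1 := by
    intro x
    induction x using Int.induction_on with
    | zero => exact ⟨1, by rw [cartMatrix_one]; exact (flagMatrix_zero_one n).symm⟩
    | succ i ih => simpa [Zsqrtd.ext_iff] using! step _ ih 1
    | pred i ih =>
      have := step _ ih (-1)
      have e : (⟨-(i : ℤ), 0⟩ : GaussianInt) + ((-1 : GaussianIntˣ) : GaussianInt) =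
        ⟨-(i : ℤ) - 1, 0⟩ := by ext <;> simp; rfl
      rwa [e] at this
  have im : ∀ x y : ℤ, ∃ g, cartMatrix n g = flagMatrix n ⟨x, y⟩ 1 := by
    intro x y
    induction y using Int.induction_on with
    | zero => exact re x
    | succ i ih =>
      have := step _ ih gaussianI
      have e : (⟨x, (i : ℤ)⟩ : GaussianInt) + (gaussianI : GaussianInt) =
        ⟨x, (i : ℤ) + 1⟩ := by ext <;> simp [gaussianI]
      rwa [e] at this
    | pred i ih =>
      have := step _ ih (gaussianI⁻¹)
      have e : (⟨x, -(i : ℤ)⟩ : GaussianInt) + ((gaussianI⁻¹ : GaussianIntˣ) : GaussianInt) =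
        ⟨x, -(i : ℤ) - 1⟩ := by ext <;> simp [gaussianI]; rfl
      rwa [e] at this
  obtain ⟨P, d, rfl⟩ := gridFlag_surj a
  rw [gridMatrix_mk hn]
  exact rot P (im P.re P.im) d

theorem squareTilingMap_matrix_injective (n : ℕ) :
    Function.Injective fun x : (squareTilingMap n).Flag =>
      (x.1.unop : Matrix (Fin 3) (Fin 3) (ZMod n)) := fun _ _ h =>
  Subtype.ext (MulOpposite.unop_injective (Units.ext h))

theorem exists_flag_of_gridFlag {n : ℕ} (hn : 3 ≤ n) (a : (squareGrid (gridSize n)).Flag) :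
    ∃ x : (squareTilingMap n).Flag,
      (x.1.unop : Matrix (Fin 3) (Fin 3) (ZMod n)) = gridMatrix n a := by
  obtain ⟨g, hg⟩ := gridMatrix_mem_range hn a
  exact ⟨⟨_, g, rfl⟩, hg⟩

theorem exists_gridFlag_of_flag {n : ℕ} (hn : 3 ≤ n) (x : (squareTilingMap n).Flag) :
    ∃ a, gridMatrix n a = (x.1.unop : Matrix (Fin 3) (Fin 3) (ZMod n)) := by
  obtain ⟨_, g, rfl⟩ := x
  obtain ⟨p, hp⟩ := exists_gridMatrix_eq_mul_cartMatrix hn g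
  have h := hp (Ideal.Quotient.mk _ 0, 1)
  rw [gridMatrix_mk hn, Units.val_one, flagMatrix_zero_one, one_mul] at h
  exact ⟨_, h⟩

/-- Left multiplication in the opposite group is right multiplication of matrices. -/
theorem squareTilingMap_rhoV_matrix {n : ℕ} (x : (squareTilingMap n).Flag) :
    ((((squareTilingMap n).rhoV x).1.unop : GL (Fin 3) (ZMod n)) : Matrix (Fin 3) (Fin 3) (ZMod n))
      = (x.1.unop : Matrix (Fin 3) (Fin 3) (ZMod n)) * matV 0 (-1) := by
  rw [← cartMatrix_v]
  rfl

theorem squareTilingMap_rhoE_matrix {n : ℕ} (x : (squareTilingMap n).Flag) :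
    ((((squareTilingMap n).rhoE x).1.unop : GL (Fin 3) (ZMod n)) : Matrix (Fin 3) (Fin 3) (ZMod n))
      = (x.1.unop : Matrix (Fin 3) (Fin 3) (ZMod n)) * matE 0 (-1) := by
  rw [← cartMatrix_e]
  rfl

/-- A bijection of the flags that commutes with `ρ_v` and `ρ_e` is an isomorphism. -/
def OrientedMap.Iso.ofRhoVRhoE {M N : OrientedMap} (φ : M.Flag ≃ N.Flag)
    (hV : ∀ d, φ (M.rhoV d) = N.rhoV (φ d)) (hE : ∀ d, φ (M.rhoE d) = N.rhoE (φ d)) :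
    M.Iso N where
  toEquiv := φ
  map_rhoV := hV
  map_rhoE := hE
  map_rhoF d := by
    have hM : ∀ x, M.rhoF (M.rhoE (M.rhoV x)) = x := fun x => congrArg (fun p => p x) M.rel
    have hN : ∀ x, N.rhoF (N.rhoE (N.rhoV x)) = x := fun x => congrArg (fun p => p x) N.rel
    obtain ⟨x, rfl⟩ := (M.rhoE * M.rhoV).surjective d
    rw [Equiv.Perm.mul_apply, hM, hE, hV, hN]

theorem nonempty_squareTilingMap_iso {n : ℕ} (hn : 3 ≤ n) :
    Nonempty ((squareTilingMap n).Iso (squareGrid (gridSize n))) := by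
  choose φ hφ using exists_gridFlag_of_flag hn
  have bij : Function.Bijective φ := by
    refine ⟨fun x y h => squareTilingMap_matrix_injective n ?_, fun a => ?_⟩
    · simp only
      rw [← hφ, ← hφ, h]
    · obtain ⟨x, hx⟩ := exists_flag_of_gridFlag hn a
      exact ⟨x, gridMatrix_injective hn (by rw [hφ, hx])⟩
  refine ⟨.ofRhoVRhoE (Equiv.ofBijective φ bij) (fun x => ?_) (fun x => ?_)⟩
  · apply gridMatrix_injective hn
    rw [gridMatrix_rhoV hn, Equiv.ofBijective_apply, Equiv.ofBijective_apply, hφ, hφ,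
      squareTilingMap_rhoV_matrix]
  · apply gridMatrix_injective hn
    rw [gridMatrix_rhoE hn, Equiv.ofBijective_apply, Equiv.ofBijective_apply, hφ, hφ,
      squareTilingMap_rhoE_matrix]

/-! ### Meromorphic functions that agree near a point -/

-- Identity theorem: f - g has infinite order at x, and infinite order propagates over a
-- preconnected set. The conclusion is only on a punctured neighbourhood, since values at poles are
-- arbitrary.
open Filter Topology in
theorem MeromorphicOn.eventuallyEq_nhdsNE_of_isPreconnected {f g : ℂ → ℂ} {U : Set ℂ}
    (hf : MeromorphicOn f U) (hg : MeromorphicOn g U) (hU : IsPreconnected U) {x y : ℂ}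
    (hx : x ∈ U) (hy : y ∈ U) (h : ∃ᶠ z in 𝓝[≠] x, f z = g z) : f =ᶠ[𝓝[≠] y] g := by
  have hfg : MeromorphicOn (fun z => f z - g z) U := fun z hz => (hf z hz).fun_sub (hg z hz)
  have hx0 : meromorphicOrderAt (fun z => f z - g z) x = ⊤ := by
    rw [meromorphicOrderAt_eq_top_iff]
    refine ((hfg x hx).eventually_eq_zero_or_eventually_ne_zero).resolve_right fun h' => ?_
    obtain ⟨z, hz, hz'⟩ := (h.and_eventually h').exists
    exact hz' (sub_eq_zero.mpr hz)
  have hy0 : meromorphicOrderAt (fun z => f z - g z) y = ⊤ := by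
    by_contra hne
    exact hfg.meromorphicOrderAt_ne_top_of_isPreconnected hU hy hx hne hx0
  rw [meromorphicOrderAt_eq_top_iff] at hy0
  filter_upwards [hy0] with z hz using sub_eq_zero.mp hz

open Filter Topology in
theorem Meromorphic.eventuallyEq_nhdsNE {f g : ℂ → ℂ} (hf : Meromorphic f) (hg : Meromorphic g)
    {x : ℂ} (y : ℂ) (h : ∃ᶠ z in 𝓝[≠] x, f z = g z) : f =ᶠ[𝓝[≠] y] g :=
  MeromorphicOn.eventuallyEq_nhdsNE_of_isPreconnected (U := Set.univ) (fun z _ => hf z)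
    (fun z _ => hg z) isPreconnected_univ trivial trivial h

/-! ### The fibres of the Weierstrass function -/

namespace PeriodPair

open Filter Topology

variable (L : PeriodPair)

theorem compl_lattice_mem_nhds {z : ℂ} (hz : z ∉ L.lattice) : (L.lattice : Set ℂ)ᶜ ∈ 𝓝 z :=
  L.isClosed_lattice.isOpen_compl.mem_nhds hz

theorem compl_lattice_mem_nhdsNE (z : ℂ) : (L.lattice : Set ℂ)ᶜ ∈ 𝓝[≠] z := by
  filter_upwards [self_mem_nhdsWithin, mem_nhdsWithin_of_mem_nhds
    (L.compl_lattice_sdiff_singleton_mem_nhds z)] with w hw hw'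
  simp_all

theorem order_derivWeierstrassP {l : ℂ} (h : l ∈ L.lattice) :
    meromorphicOrderAt L.derivWeierstrassP l = -3 := by
  rw [← deriv_weierstrassP]
  exact meromorphicOrderAt_deriv_eq_sub_one (n := -2) (by norm_num) (L.order_weierstrassP l h)

theorem hasDerivAt_weierstrassP {z : ℂ} (hz : z ∉ L.lattice) :
    HasDerivAt L.weierstrassP (L.derivWeierstrassP z) z := by
  rw [← deriv_weierstrassP]
  exact (L.analyticOnNhd_weierstrassP z hz).differentiableAt.hasDerivAt

/-- Differentiating ℘'² = 4℘³ - g₂℘ - g₃ gives the claim multiplied by ℘'. Near the pole at 0 the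
factor ℘' does not vanish and cancels; the identity theorem and continuity carry the result to every
z off the lattice. -/
theorem hasDerivAt_derivWeierstrassP {z : ℂ} (hz : z ∉ L.lattice) :
    HasDerivAt L.derivWeierstrassP (6 * L.weierstrassP z ^ 2 - L.g₂ / 2) z := by
  have an := L.analyticOnNhd_derivWeierstrassP
  have key : ∀ w ∉ L.lattice, L.derivWeierstrassP w * deriv L.derivWeierstrassP w =
      L.derivWeierstrassP w * (6 * L.weierstrassP w ^ 2 - L.g₂ / 2) := by
    intro w hw
    have h1 : (fun z => L.derivWeierstrassP z ^ 2) =ᶠ[𝓝 w]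
        fun z => 4 * L.weierstrassP z ^ 3 - L.g₂ * L.weierstrassP z - L.g₃ := by
      filter_upwards [L.compl_lattice_mem_nhds hw] with z hz using L.derivWeierstrassP_sq z hz
    have d1 := (an w hw).differentiableAt.hasDerivAt.pow 2
    have d2 := (((L.hasDerivAt_weierstrassP hw).pow 3).const_mul 4).sub
      ((L.hasDerivAt_weierstrassP hw).const_mul L.g₂) |>.sub_const L.g₃
    have := d1.unique (d2.congr_of_eventuallyEq h1)
    simp only [Nat.cast_ofNat, Nat.add_one_sub_one, pow_one] at this
    linear_combination this / 2
  have hne : ∀ᶠ w in 𝓝[≠] (0 : ℂ), L.derivWeierstrassP w ≠ 0 := by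
    rw [← meromorphicOrderAt_ne_top_iff_eventually_ne_zero (L.meromorphic_derivWeierstrassP 0),
      L.order_derivWeierstrassP (zero_mem _)]
    decide
  have h0 : deriv L.derivWeierstrassP =ᶠ[𝓝[≠] 0]
      fun w => 6 * L.weierstrassP w ^ 2 - L.g₂ / 2 := by
    filter_upwards [hne, L.compl_lattice_mem_nhdsNE 0] with w h1 h2
    exact mul_left_cancel₀ h1 (key w h2)
  have m1 : Meromorphic (deriv L.derivWeierstrassP) := by fun_prop
  have m2 : Meromorphic fun w => 6 * L.weierstrassP w ^ 2 - L.g₂ / 2 := by fun_prop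
  have hz' := m1.eventuallyEq_nhdsNE m2 z h0.frequently
  have c1 := (an z hz).deriv.continuousAt
  have c2 : ContinuousAt (fun w => 6 * L.weierstrassP w ^ 2 - L.g₂ / 2) z := by
    have := (L.analyticOnNhd_weierstrassP z hz).continuousAt
    fun_prop
  have := ((c1.eventuallyEq_nhds_iff_eventuallyEq_nhdsNE c2).mp hz').eq_of_nhds
  rw [← this]
  exact (an z hz).differentiableAt.hasDerivAt

/-- The two translates of ℘ then agree as meromorphic functions. At t = -w the second has a double
pole, hence so does the first, and z - w must be a pole of ℘. -/
theorem sub_mem_lattice_of_eventuallyEq {z w : ℂ}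
    (h : ∃ᶠ t in 𝓝[≠] (0 : ℂ), L.weierstrassP (z + t) = L.weierstrassP (w + t)) :
    z - w ∈ L.lattice := by
  have an : ∀ a b : ℂ, AnalyticAt ℂ (fun t => a + t) b := fun a b => by fun_prop
  have ord : ∀ a b : ℂ, meromorphicOrderAt (fun t => L.weierstrassP (a + t)) b =
      meromorphicOrderAt L.weierstrassP (a + b) := fun a b =>
    meromorphicOrderAt_comp_of_deriv_ne_zero (f := L.weierstrassP) (an a b) (by simp)
  have m : ∀ a : ℂ, Meromorphic fun t => L.weierstrassP (a + t) := fun a b =>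
    (L.meromorphic_weierstrassP (a + b)).comp_analyticAt (an a b)
  have h1 := meromorphicOrderAt_congr ((m z).eventuallyEq_nhdsNE (m w) (-w) h)
  rw [ord, ord, add_neg_cancel, L.order_weierstrassP 0 (zero_mem _), ← sub_eq_add_neg] at h1
  by_contra hzw
  have := (L.analyticOnNhd_weierstrassP _ hzw).meromorphicOrderAt_nonneg
  rw [h1] at this
  exact absurd this (by decide)

/-- The pair (℘, ℘') solves the autonomous system p' = q, q' = 6p² - g₂/2, so its value at one point
determines its germ. Uniqueness along the real direction suffices, because agreement on a real
interval already feeds the identity theorem. -/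
theorem sub_mem_lattice_of_eq_of_eq {z w : ℂ} (hz : z ∉ L.lattice) (hw : w ∉ L.lattice)
    (h : L.weierstrassP z = L.weierstrassP w)
    (h' : L.derivWeierstrassP z = L.derivWeierstrassP w) : z - w ∈ L.lattice := by
  let v : ℂ × ℂ → ℂ × ℂ := fun y => (y.2, 6 * y.1 ^ 2 - L.g₂ / 2)
  let Y : ℂ → ℝ → ℂ × ℂ := fun a t => (L.weierstrassP (a + t), L.derivWeierstrassP (a + t))
  have dY : ∀ a ∉ L.lattice, ∀ᶠ t : ℝ in 𝓝 0, HasDerivAt (Y a) (v (Y a t)) t := by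
    intro a ha
    have c : ContinuousAt (fun t : ℝ => a + (t : ℂ)) 0 := by fun_prop
    have : ∀ᶠ t : ℝ in 𝓝 0, a + (t : ℂ) ∉ L.lattice :=
      c.eventually (by
        simpa only [Complex.ofReal_zero, add_zero] using! L.compl_lattice_mem_nhds ha)
    filter_upwards [this] with t ht
    have d : HasDerivAt (fun t : ℝ => a + (t : ℂ)) 1 t :=
      (Complex.ofRealCLM.hasDerivAt (x := t)).const_add a
    have d1 := (L.hasDerivAt_weierstrassP ht).comp t d
    have d2 := (L.hasDerivAt_derivWeierstrassP ht).comp t d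
    rw [mul_one] at d1 d2
    exact d1.prodMk d2
  have hv : ContDiffAt ℝ 1 v (Y z 0) := by fun_prop
  obtain ⟨K, s, hs, hK⟩ := hv.exists_lipschitzOnWith
  have h0 : Y z 0 = Y w 0 := by simp [Y, h, h']
  have sY : ∀ a ∉ L.lattice, Y a 0 = Y z 0 → ∀ᶠ t : ℝ in 𝓝 0, Y a t ∈ s := by
    intro a ha e
    exact (dY a ha).self_of_nhds.continuousAt.eventually (by rwa [e])
  have := ODE_solution_unique_of_eventually (v := fun _ => v) (s := fun _ => s)
    (Eventually.of_forall fun _ => hK) ((dY z hz).and (sY z hz rfl))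
    ((dY w hw).and (sY w hw h0.symm)) h0
  apply L.sub_mem_lattice_of_eventuallyEq
  have ev : ∀ᶠ t : ℝ in 𝓝[≠] 0, L.weierstrassP (z + t) = L.weierstrassP (w + t) := by
    filter_upwards [this.filter_mono nhdsWithin_le_nhds] with t ht using congrArg Prod.fst ht
  have tend : Tendsto (fun t : ℝ => (t : ℂ)) (𝓝[≠] 0) (𝓝[≠] 0) := by
    refine tendsto_nhdsWithin_iff.mpr ⟨?_, ?_⟩
    · exact (Complex.continuous_ofReal.tendsto' 0 0 (by simp)).mono_left nhdsWithin_le_nhds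
    · filter_upwards [self_mem_nhdsWithin] with t ht
      simpa using ht
  exact tend.frequently ev.frequently

/-- The fibres of `℘` are the orbits of the reflections. -/
theorem sub_mem_lattice_or_add_mem_lattice {z w : ℂ} (hz : z ∉ L.lattice) (hw : w ∉ L.lattice)
    (h : L.weierstrassP z = L.weierstrassP w) : z - w ∈ L.lattice ∨ z + w ∈ L.lattice := by
  have h2 : L.derivWeierstrassP z ^ 2 = L.derivWeierstrassP w ^ 2 := by
    rw [L.derivWeierstrassP_sq z hz, L.derivWeierstrassP_sq w hw, h]
  rcases sq_eq_sq_iff_eq_or_eq_neg.mp h2 with h3 | h3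
  · exact .inl (L.sub_mem_lattice_of_eq_of_eq hz hw h h3)
  · have := L.sub_mem_lattice_of_eq_of_eq (w := -w) hz (by simpa using hw) (by simpa using h)
      (by simpa using h3)
    exact .inr (by simpa using this)

theorem tendsto_weierstrassP_cobounded {l : ℂ} (h : l ∈ L.lattice) :
    Tendsto L.weierstrassP (𝓝[≠] l) (Bornology.cobounded ℂ) :=
  tendsto_cobounded_of_meromorphicOrderAt_neg (by rw [L.order_weierstrassP l h]; decide)

/-- If ℘ omitted c, then 1/(℘ - c), extended by 0 over the lattice, would be entire and doubly
periodic, hence constant by Liouville. But it is 0 at 0 and nonzero at ω₁/2. -/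
theorem exists_weierstrassP_eq (c : ℂ) : ∃ z ∉ L.lattice, L.weierstrassP z = c := by
  by_contra! hc
  classical
  let h : ℂ → ℂ := fun z => if z ∈ L.lattice then 0 else (L.weierstrassP z - c)⁻¹
  have da : ∀ z ∉ L.lattice, DifferentiableAt ℂ h z := by
    intro z hz
    have : h =ᶠ[𝓝 z] fun w => (L.weierstrassP w - c)⁻¹ := by
      filter_upwards [L.compl_lattice_mem_nhds hz] with w hw using if_neg hw
    refine DifferentiableAt.congr_of_eventuallyEq ?_ this
    exact ((L.hasDerivAt_weierstrassP hz).differentiableAt.sub_const c).inv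
      (sub_ne_zero.mpr (hc z hz))
  have hd : Differentiable ℂ h := by
    intro z
    by_cases hz : z ∈ L.lattice
    · refine (Complex.analyticAt_of_differentiable_on_punctured_nhds_of_continuousAt ?_
        ?_).differentiableAt
      · filter_upwards [L.compl_lattice_mem_nhdsNE z] with w hw using da w hw
      · rw [continuousAt_iff_punctured_nhds]
        have hz0 : h z = 0 := if_pos hz
        rw [hz0]
        have t1 : Tendsto (fun w => L.weierstrassP w - c) (𝓝[≠] z) (Bornology.cobounded ℂ) := by
          rw [← tendsto_norm_atTop_iff_cobounded]
          refine tendsto_atTop_mono (fun w => norm_sub_norm_le _ _)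
            (tendsto_atTop_add_const_right _ (-‖c‖)
              (tendsto_norm_atTop_iff_cobounded.mpr (L.tendsto_weierstrassP_cobounded hz)))
        refine (Filter.tendsto_inv₀_cobounded.comp t1).congr' ?_
        filter_upwards [L.compl_lattice_mem_nhdsNE z] with w hw
        exact (if_neg hw).symm
    · exact da z hz
  have per : ∀ z w, w ∈ L.lattice → h (z + w) = h z := by
    intro z w hw
    have e : z + w ∈ L.lattice ↔ z ∈ L.lattice := by
      simpa using (L.lattice.toAddSubgroup.add_mem_cancel_right (y := z) hw)
    have := L.weierstrassP_add_coe z ⟨w, hw⟩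
    simp only at this
    simp only [h, e, this]
  have bdd := (IsZLattice.isCompact_range_of_periodic L.lattice h hd.continuous per).isBounded
  have hz := hd.apply_eq_apply_of_bounded bdd (L.ω₁ / 2) 0
  simp only [h, if_neg L.ω₁_div_two_notMem_lattice, if_pos (zero_mem L.lattice)] at hz
  exact hc _ L.ω₁_div_two_notMem_lattice (sub_eq_zero.mp (inv_eq_zero.mp hz))

/-- ℘' is odd and periodic, and z ≡ -z modulo the lattice. -/
theorem derivWeierstrassP_eq_zero_of_two_mul {z : ℂ} (h : 2 * z ∈ L.lattice) :
    L.derivWeierstrassP z = 0 := by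
  have h1 := L.derivWeierstrassP_sub_coe z ⟨_, h⟩
  simp only [show z - 2 * z = -z by ring, derivWeierstrassP_neg] at h1
  exact self_eq_neg.mp h1.symm

end PeriodPair

section GaussianLattice

open Complex Filter Topology

/-! ### The Weierstrass function of the Gaussian lattice -/

/-- The pair of periods `1`, `i`. -/
def gaussianPeriods : PeriodPair where
  ω₁ := 1
  ω₂ := Complex.I
  indep := by
    rw [LinearIndependent.pair_iff]
    intro s t h
    have h1 := congrArg re h
    have h2 := congrArg im h
    simp at h1 h2
    exact ⟨h1, h2⟩

theorem gaussianPeriods_lattice : gaussianPeriods.lattice = gaussianLattice := rfl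

theorem mem_gaussianLattice {z : ℂ} :
    z ∈ gaussianLattice ↔ ∃ m n : ℤ, (m : ℂ) + n * Complex.I = z := by
  rw [← gaussianPeriods_lattice, PeriodPair.mem_lattice]
  simp [gaussianPeriods]

theorem one_mem_gaussianLattice : (1 : ℂ) ∈ gaussianLattice := Submodule.subset_span (by simp)

theorem I_mul_mem_gaussianLattice {z : ℂ} :
    Complex.I * z ∈ gaussianLattice ↔ z ∈ gaussianLattice := by
  have key : ∀ w ∈ gaussianLattice, Complex.I * w ∈ gaussianLattice := by
    intro w hw
    obtain ⟨m, n, rfl⟩ := mem_gaussianLattice.mp hw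
    refine mem_gaussianLattice.mpr ⟨-n, m, ?_⟩
    push_cast
    linear_combination (-n : ℂ) * I_mul_I
  refine ⟨fun h => ?_, key z⟩
  have := neg_mem (key _ h)
  rwa [← mul_assoc, I_mul_I, neg_one_mul, neg_neg] at this

theorem conj_mem_gaussianLattice {z : ℂ} (hz : z ∈ gaussianLattice) :
    (starRingEnd ℂ) z ∈ gaussianLattice := by
  obtain ⟨m, n, rfl⟩ := mem_gaussianLattice.mp hz
  exact mem_gaussianLattice.mpr ⟨m, -n, by simp⟩

theorem half_notMem_gaussianLattice : (1 / 2 : ℂ) ∉ gaussianLattice :=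
  gaussianPeriods.ω₁_div_two_notMem_lattice

/-- Multiplication by `i` on the Gaussian lattice. -/
noncomputable def gaussianLatticeMulI : gaussianLattice ≃ gaussianLattice where
  toFun l := ⟨Complex.I * l, I_mul_mem_gaussianLattice.mpr l.2⟩
  invFun l := ⟨-(Complex.I * l), neg_mem (I_mul_mem_gaussianLattice.mpr l.2)⟩
  left_inv l := Subtype.ext (by simp [← mul_assoc])
  right_inv l := Subtype.ext (by simp [← mul_assoc])

/-- Complex conjugation on the Gaussian lattice. -/
noncomputable def gaussianLatticeConj : gaussianLattice ≃ gaussianLattice where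
  toFun l := ⟨_, conj_mem_gaussianLattice l.2⟩
  invFun l := ⟨_, conj_mem_gaussianLattice l.2⟩
  left_inv l := Subtype.ext (by simp)
  right_inv l := Subtype.ext (by simp)

/-- The Weierstrass function of the Gaussian lattice. -/
noncomputable def gaussianP : ℂ → ℂ := gaussianPeriods.weierstrassP

/-- The derivative of the Weierstrass function of the Gaussian lattice. -/
noncomputable def gaussianP' : ℂ → ℂ := gaussianPeriods.derivWeierstrassP

/-- Reindexing the lattice by l ↦ il multiplies each term of the series by i⁻² = -1. -/
theorem gaussianP_I_mul (z : ℂ) : gaussianP (Complex.I * z) = -gaussianP z := by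
  change ∑' l : gaussianLattice, _ = -∑' l : gaussianLattice, _
  rw [← gaussianLatticeMulI.tsum_eq, ← tsum_neg]
  congr with l
  simp only [gaussianLatticeMulI, Equiv.coe_fn_mk, ← mul_sub, mul_pow, I_sq, neg_one_mul, div_neg]
  ring

theorem gaussianP_conj (z : ℂ) :
    gaussianP ((starRingEnd ℂ) z) = (starRingEnd ℂ) (gaussianP z) := by
  change ∑' l : gaussianLattice, _ = (starRingEnd ℂ) (∑' l : gaussianLattice, _)
  rw [← gaussianLatticeConj.tsum_eq, conj_tsum]
  congr with l
  simp [gaussianLatticeConj]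

theorem gaussianPeriods_g₃ : gaussianPeriods.g₃ = 0 := by
  have : gaussianPeriods.G 6 = -gaussianPeriods.G 6 := by
    change ∑' l : gaussianLattice, _ = -∑' l : gaussianLattice, _
    refine (gaussianLatticeMulI.tsum_eq _).symm.trans ?_
    rw [← tsum_neg]
    congr with l
    simp only [gaussianLatticeMulI, Equiv.coe_fn_mk, mul_pow,
      show Complex.I ^ 6 = -1 by rw [show 6 = 2 * 3 by rfl, pow_mul, I_sq]; norm_num]
    rw [neg_one_mul, inv_neg]
  rw [PeriodPair.g₃, self_eq_neg.mp this, mul_zero]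

theorem gaussianP_of_mem {z : ℂ} (hz : z ∈ gaussianLattice) : gaussianP z = 0 :=
  gaussianPeriods.weierstrassP_coe ⟨z, hz⟩

theorem gaussianP_add {z l : ℂ} (hl : l ∈ gaussianLattice) : gaussianP (z + l) = gaussianP z :=
  gaussianPeriods.weierstrassP_add_coe z ⟨l, hl⟩

theorem gaussianP'_add {z l : ℂ} (hl : l ∈ gaussianLattice) : gaussianP' (z + l) = gaussianP' z :=
  gaussianPeriods.derivWeierstrassP_add_coe z ⟨l, hl⟩

theorem gaussianP_neg (z : ℂ) : gaussianP (-z) = gaussianP z :=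
  gaussianPeriods.weierstrassP_neg z

/-- The value of the Weierstrass function of the Gaussian lattice at `1/2`. -/
noncomputable def gaussianE : ℝ := (gaussianP (1 / 2)).re

theorem gaussianP_half : gaussianP (1 / 2) = gaussianE := by
  have := gaussianP_conj (1 / 2)
  simp only [map_div₀, map_one, map_ofNat] at this
  exact (conj_eq_iff_re.mp this.symm).symm

theorem gaussianP_eq_of_ne {z w : ℂ} (hz : z ∉ gaussianLattice) (hw : w ∉ gaussianLattice)
    (h : gaussianP z = gaussianP w) : z - w ∈ gaussianLattice ∨ z + w ∈ gaussianLattice :=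
  gaussianPeriods.sub_mem_lattice_or_add_mem_lattice hz hw h

/-- Since i(1+i)/2 ≡ (1+i)/2 modulo the lattice, ℘ vanishes at (1+i)/2. If it vanished at 1/2 too,
these points would be congruent up to sign, which their imaginary parts forbid. -/
theorem gaussianE_ne_zero : gaussianE ≠ 0 := by
  intro h0
  have h1 : gaussianP ((1 + Complex.I) / 2) = 0 := by
    have h2 := gaussianP_I_mul ((1 + Complex.I) / 2)
    have e : Complex.I * ((1 + Complex.I) / 2) = (1 + Complex.I) / 2 + -1 := by
      linear_combination I_mul_I / 2
    rw [e, gaussianP_add (neg_mem one_mem_gaussianLattice)] at h2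
    exact self_eq_neg.mp h2
  have notMem : ∀ c : ℂ, c.re = 0 → c.im = 1 / 2 → c ∉ gaussianLattice := by
    intro c hc1 hc h
    obtain ⟨m, n, rfl⟩ := mem_gaussianLattice.mp h
    simp at hc
    have : (n : ℝ) * 2 = 1 := by rw [hc]; norm_num
    norm_cast at this
    omega
  have h3 : (1 + Complex.I) / 2 ∉ gaussianLattice := by
    intro h
    obtain ⟨m, n, hmn⟩ := mem_gaussianLattice.mp h
    have := congrArg im hmn
    simp at this
    have : (n : ℝ) * 2 = 1 := by rw [this]; norm_num
    norm_cast at this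
    omega
  have h4 : gaussianP (1 / 2) = gaussianP ((1 + Complex.I) / 2) := by
    rw [h1, gaussianP_half, h0, ofReal_zero]
  rcases gaussianP_eq_of_ne half_notMem_gaussianLattice h3 h4 with h | h
  · refine notMem (-(1 / 2 - (1 + Complex.I) / 2)) ?_ ?_ (neg_mem h) <;> simp
  · refine notMem (1 / 2 + (1 + Complex.I) / 2 - 1) ?_ ?_ (sub_mem h one_mem_gaussianLattice) <;> simp
    norm_num

/-- The cubic equation at 1/2, where ℘' vanishes, reads 0 = 4e³ - g₂e. -/
theorem gaussianPeriods_g₂ : gaussianPeriods.g₂ = 4 * (gaussianE : ℂ) ^ 2 := by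
  have h1 := gaussianPeriods.derivWeierstrassP_sq (1 / 2) half_notMem_gaussianLattice
  rw [gaussianPeriods.derivWeierstrassP_eq_zero_of_two_mul
    (by simpa using! one_mem_gaussianLattice), gaussianPeriods_g₃] at h1
  change 0 ^ 2 = 4 * gaussianP (1 / 2) ^ 3 - _ * gaussianP (1 / 2) - 0 at h1
  rw [gaussianP_half] at h1
  have h2 : (gaussianE : ℂ) ≠ 0 := ofReal_ne_zero.mpr gaussianE_ne_zero
  apply mul_right_cancel₀ h2
  linear_combination h1

theorem gaussianP'_sq {z : ℂ} (hz : z ∉ gaussianLattice) :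
    gaussianP' z ^ 2 = 4 * gaussianP z * (gaussianP z ^ 2 - (gaussianE : ℂ) ^ 2) := by
  have := gaussianPeriods.derivWeierstrassP_sq z hz
  rw [gaussianPeriods_g₂, gaussianPeriods_g₃] at this
  change gaussianP' z ^ 2 = 4 * gaussianP z ^ 3 - _ * gaussianP z - 0 at this
  linear_combination this

theorem hasDerivAt_gaussianP {z : ℂ} (hz : z ∉ gaussianLattice) :
    HasDerivAt gaussianP (gaussianP' z) z :=
  gaussianPeriods.hasDerivAt_weierstrassP hz

theorem analyticAt_gaussianP {z : ℂ} (hz : z ∉ gaussianLattice) : AnalyticAt ℂ gaussianP z :=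
  gaussianPeriods.analyticOnNhd_weierstrassP z hz

theorem order_gaussianP {z : ℂ} (hz : z ∈ gaussianLattice) :
    meromorphicOrderAt gaussianP z = -2 :=
  gaussianPeriods.order_weierstrassP z hz

theorem meromorphic_gaussianP : Meromorphic gaussianP := gaussianPeriods.meromorphic_weierstrassP

/-! ### The curve `y ^ 2 = x ^ 3 + x` -/

theorem curveE_equation_iff (x y : ℂ) : curveE.toAffine.Equation x y ↔ y ^ 2 = x ^ 3 + x := by
  rw [WeierstrassCurve.Affine.equation_iff]
  simp [curveE]

theorem curveE_nonsingular_iff (x y : ℂ) :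
    curveE.toAffine.Nonsingular x y ↔ y ^ 2 = x ^ 3 + x := by
  rw [← curveE_equation_iff, WeierstrassCurve.Affine.equation_iff_nonsingular]

theorem curveE_j : curveE.j = 1728 := by
  rw [WeierstrassCurve.j, Units.val_inv_eq_inv_val, WeierstrassCurve.coe_Δ']
  norm_num [curveE, WeierstrassCurve.Δ, WeierstrassCurve.c₄, WeierstrassCurve.b₂,
    WeierstrassCurve.b₄, WeierstrassCurve.b₆, WeierstrassCurve.b₈]

open Classical in
theorem isComplexTorus_curveE : IsComplexTorus curveE gaussianLattice := by
  have he : (gaussianE : ℂ) ≠ 0 := ofReal_ne_zero.mpr gaussianE_ne_zero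
  -- With x = l℘ and y = μ℘', the equation ℘'² = 4℘³ - 4e²℘ becomes y² = x³ + x exactly when μ² =
  -- l³/4 and l²e² = -1; hence l = i/e. Rescaling the coordinates leaves the lattice ⟨1, i⟩
  -- unchanged.
  obtain ⟨μ, hμ⟩ : ∃ μ : ℂ, μ ^ 2 = (Complex.I / gaussianE) ^ 3 / 4 :=
    IsAlgClosed.exists_pow_nat_eq _ two_pos
  set l : ℂ := Complex.I / gaussianE with hl
  have hl2 : l ^ 2 * gaussianE ^ 2 = -1 := by rw [hl, div_pow, I_sq]; field_simp
  have hl0 : l ≠ 0 := by rintro h; simp [h] at hl2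
  have hμ0 : μ ≠ 0 := by
    rintro rfl
    have : l ^ 3 = 0 := by linear_combination -4 * hμ
    exact hl0 (by simpa using this)
  let x : ℂ → ℂ := fun z => l * gaussianP z
  let y : ℂ → ℂ := fun z => μ * gaussianP' z
  have hxy : ∀ z ∉ gaussianLattice, curveE.toAffine.Nonsingular (x z) (y z) := by
    intro z hz
    rw [curveE_nonsingular_iff]
    simp only [x, y, mul_pow, hμ, gaussianP'_sq hz]
    linear_combination -l * gaussianP z * hl2
  let ψ : ℂ → curveE.toAffine.Point := fun z =>
    if hz : z ∈ gaussianLattice then .zero else .some (x z) (y z) (hxy z hz)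
  have ψ_mem : ∀ z ∈ gaussianLattice, ψ z = .zero := fun z hz => dif_pos hz
  have ψ_notMem : ∀ z (hz : z ∉ gaussianLattice), ψ z = .some (x z) (y z) (hxy z hz) :=
    fun z hz => dif_neg hz
  have ψ_eq : ∀ z w, ψ z = ψ w ↔ z - w ∈ gaussianLattice := by
    intro z w
    constructor
    · intro h
      by_cases hz : z ∈ gaussianLattice <;> by_cases hw : w ∈ gaussianLattice
      · exact sub_mem hz hw
      · rw [ψ_mem z hz, ψ_notMem w hw] at h
        cases h
      · rw [ψ_mem w hw, ψ_notMem z hz] at h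
        cases h
      · rw [ψ_notMem z hz, ψ_notMem w hw] at h
        obtain ⟨h1, h2⟩ := WeierstrassCurve.Affine.Point.some.inj h
        exact gaussianPeriods.sub_mem_lattice_of_eq_of_eq hz hw (mul_left_cancel₀ hl0 h1)
          (mul_left_cancel₀ hμ0 h2)
    · intro h
      have e : w + (z - w) = z := by ring
      have e1 := gaussianP_add (z := w) h
      have e2 := gaussianP'_add (z := w) h
      rw [e] at e1 e2
      by_cases hw : w ∈ gaussianLattice
      · rw [ψ_mem w hw, ψ_mem z (by rw [← e]; exact add_mem hw h)]
      · rw [ψ_notMem w hw, ψ_notMem z (fun hz => hw (by simpa using sub_mem hz h))]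
        simp only [x, y, e1, e2]
  have ψ_surj : Function.Surjective ψ := by
    rintro (_ | ⟨a, b, hab⟩)
    · exact ⟨0, ψ_mem 0 (zero_mem _)⟩
    · obtain ⟨z, (hz : z ∉ gaussianLattice), hza⟩ := gaussianPeriods.exists_weierstrassP_eq (a / l)
      have hxz : x z = a := by
        simp only [x, gaussianP, hza]
        field_simp
      -- The abscissa fixes the ordinate up to sign, and z ↦ -z realizes the sign change.
      have hyz : y z ^ 2 = b ^ 2 := by
        rw [(curveE_nonsingular_iff _ _).mp (hxy z hz), (curveE_nonsingular_iff _ _).mp hab, hxz]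
      rcases sq_eq_sq_iff_eq_or_eq_neg.mp hyz with h | h
      · refine ⟨z, ?_⟩
        rw [ψ_notMem z hz]
        simp only [hxz, h]
      · have hz' : -z ∉ gaussianLattice := by simpa using hz
        refine ⟨-z, ?_⟩
        rw [ψ_notMem (-z) hz']
        have h1 : x (-z) = a := by simp only [x, gaussianP_neg]; exact hxz
        have h2 : y (-z) = b := by
          have : gaussianP' (-z) = -gaussianP' z := gaussianPeriods.derivWeierstrassP_neg z
          simp only [y, this]
          linear_combination -h
        simp only [h1, h2]
  let φ : ℂ ⧸ gaussianLattice → curveE.toAffine.Point :=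
    Quotient.lift ψ fun a b h => (ψ_eq a b).mpr ((Submodule.quotientRel_def _).mp h)
  have φ_bij : Function.Bijective φ := by
    constructor
    · intro p q h
      obtain ⟨z, rfl⟩ := Submodule.Quotient.mk_surjective _ p
      obtain ⟨w, rfl⟩ := Submodule.Quotient.mk_surjective _ q
      exact (Submodule.Quotient.eq _).mpr ((ψ_eq z w).mp h)
    · intro p
      obtain ⟨z, rfl⟩ := ψ_surj p
      exact ⟨Submodule.Quotient.mk z, rfl⟩
  refine ⟨Equiv.ofBijective φ φ_bij, x, y, ψ_mem 0 (zero_mem _), fun z hz => ⟨hxy z hz, ?_⟩,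
    fun z hz => ⟨?_, ?_⟩, fun z hz => ⟨?_, ?_⟩⟩
  · exact ψ_notMem z hz
  · exact analyticAt_const.mul (analyticAt_gaussianP hz)
  · exact analyticAt_const.mul (gaussianPeriods.analyticOnNhd_derivWeierstrassP z hz)
  · rw [← order_gaussianP hz]
    exact meromorphicOrderAt_mul_of_ne_zero analyticAt_const hl0
  · rw [← gaussianPeriods.order_derivWeierstrassP hz]
    exact meromorphicOrderAt_mul_of_ne_zero analyticAt_const hμ0

/-! ### The basic Belyi function of the Gaussian lattice -/

/-- The Belyi function on `ℂ/⟨1, i⟩` whose dessin is the square grid with one square. -/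
noncomputable def gaussianB (z : ℂ) : ℂ := (gaussianE : ℂ) ^ 2 / gaussianP z ^ 2

theorem ofReal_gaussianE_ne_zero : (gaussianE : ℂ) ≠ 0 := ofReal_ne_zero.mpr gaussianE_ne_zero

theorem gaussianB_add {z l : ℂ} (hl : l ∈ gaussianLattice) : gaussianB (z + l) = gaussianB z := by
  rw [gaussianB, gaussianP_add hl, gaussianB]

theorem gaussianB_eq_of_sub_mem {z w : ℂ} (h : z - w ∈ gaussianLattice) :
    gaussianB z = gaussianB w := by
  rw [← gaussianB_add (z := w) h, add_sub_cancel]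

theorem gaussianB_I_mul (z : ℂ) : gaussianB (Complex.I * z) = gaussianB z := by
  rw [gaussianB, gaussianP_I_mul, neg_sq, gaussianB]

/-- Both sides use default values: ℘ is set to 0 on the lattice, where B has its zeros, and B is set
to 0 where ℘ truly vanishes, at its poles. Thus one condition excludes zeros and poles of B
together. -/
theorem gaussianB_ne_zero_iff (z : ℂ) : gaussianB z ≠ 0 ↔ gaussianP z ≠ 0 := by
  simp [gaussianB, gaussianE_ne_zero]

theorem notMem_of_gaussianP_ne_zero {z : ℂ} (h : gaussianP z ≠ 0) : z ∉ gaussianLattice :=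
  fun hz => h (gaussianP_of_mem hz)

theorem hasDerivAt_gaussianB {z : ℂ} (h : gaussianP z ≠ 0) :
    HasDerivAt gaussianB (-2 * gaussianE ^ 2 * gaussianP' z / gaussianP z ^ 3) z := by
  have d := ((hasDerivAt_gaussianP (notMem_of_gaussianP_ne_zero h)).pow 2).inv
    (pow_ne_zero 2 h) |>.const_mul ((gaussianE : ℂ) ^ 2)
  refine (d.congr_deriv ?_).congr_of_eventuallyEq (.of_forall fun w => ?_)
  · simp only [Pi.pow_apply, Nat.cast_ofNat, Nat.add_one_sub_one, pow_one]
    field_simp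
  · simp [gaussianB, div_eq_mul_inv]

/-- The fourth power removes ℘' and the sign of ℘, leaving an equation in B alone. It shows that B
is unramified off 0, 1, ∞, and for B = s⁴ it reduces to s'⁴ = e²(1 - s⁴)², whence the integrand (1 -
s⁴)^(-1/2) of the uniformization. -/
theorem deriv_gaussianB_pow_four {z : ℂ} (h : gaussianP z ≠ 0) :
    deriv gaussianB z ^ 4 = 256 * gaussianE ^ 2 * gaussianB z ^ 3 * (1 - gaussianB z) ^ 2 := by
  have h1 : gaussianP' z ^ 4 =
      (4 * gaussianP z * (gaussianP z ^ 2 - (gaussianE : ℂ) ^ 2)) ^ 2 := by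
    rw [← gaussianP'_sq (notMem_of_gaussianP_ne_zero h)]
    ring
  rw [(hasDerivAt_gaussianB h).deriv, div_pow, mul_pow, h1, gaussianB]
  field_simp
  ring

theorem meromorphicNFAt_gaussianB (z : ℂ) : MeromorphicNFAt gaussianB z := by
  have hP : MeromorphicNFAt gaussianP z := by
    rw [meromorphicNFAt_iff_analyticAt_or]
    by_cases hz : z ∈ gaussianLattice
    · refine .inr ⟨meromorphic_gaussianP z, ?_, gaussianP_of_mem hz⟩
      rw [order_gaussianP hz]
      decide
    · exact .inl (analyticAt_gaussianP hz)
  have := (meromorphicNFAt_mul_iff_right (analyticAt_const (v := (gaussianE : ℂ) ^ 2))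
    (pow_ne_zero 2 ofReal_gaussianE_ne_zero)).mpr (hP.zpow (n := -2))
  refine (meromorphicNFAt_congr (.of_forall fun w => ?_)).mp this
  simp only [Pi.mul_apply, gaussianB, zpow_neg, div_eq_mul_inv]
  norm_cast

/-- The scale of the uniformization of the unit disc: the positive fourth root of `e ^ 2`. -/
noncomputable def gaussianScale : ℝ := √|gaussianE|

theorem gaussianScale_pos : 0 < gaussianScale :=
  Real.sqrt_pos.mpr (abs_pos.mpr gaussianE_ne_zero)

theorem gaussianScale_pow_four : (gaussianScale : ℂ) ^ 4 = (gaussianE : ℂ) ^ 2 := by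
  have : gaussianScale ^ 4 = gaussianE ^ 2 := by
    rw [show 4 = 2 * 2 by rfl, pow_mul, gaussianScale, Real.sq_sqrt (abs_nonneg _), sq_abs]
  exact_mod_cast this

/-- A local fourth root of the Belyi function at `0`. -/
theorem exists_root_gaussianB : ∃ U : ℂ → ℂ, AnalyticAt ℂ U 0 ∧ U 0 = 0 ∧
    deriv U 0 = gaussianScale ∧ ∀ᶠ z in 𝓝[≠] 0, U z ≠ 0 ∧ gaussianB z = U z ^ 4 := by
  -- Here g is z²℘(z) with its singularity at 0 removed, so that B = e²z⁴/g² and the root is a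
  -- multiple of z g^(-1/2).
  let g : ℂ → ℂ := fun z => z ^ 2 * gaussianPeriods.weierstrassPExcept 0 z + 1
  have ga : AnalyticAt ℂ g 0 := by
    have := gaussianPeriods.analyticAt_weierstrassPExcept 0
    fun_prop
  have g0 : g 0 = 1 := by simp [g]
  have gP : ∀ z ≠ 0, z ^ 2 * gaussianP z = g z := by
    intro z hz
    have := gaussianPeriods.ite_eq_one_sub_sq_mul_weierstrassP 0 (zero_mem _) z
    simpa [hz] using! this
  have slit : ∀ᶠ z in 𝓝 0, g z ∈ slitPlane :=
    ga.continuousAt.eventually (isOpen_slitPlane.mem_nhds (by rw [g0]; simp))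
  let h : ℂ → ℂ := fun z => g z ^ (-(1 / 2) : ℂ)
  have ha : AnalyticAt ℂ h 0 := ga.cpow analyticAt_const slit.self_of_nhds
  have h0 : h 0 = 1 := by simp [h, g0]
  refine ⟨fun z => gaussianScale * z * h z, by fun_prop, by simp, ?_, ?_⟩
  · have d := ((hasDerivAt_id (0 : ℂ)).const_mul (gaussianScale : ℂ)).mul
      ha.differentiableAt.hasDerivAt
    simpa [h0] using! d.deriv
  · filter_upwards [slit.filter_mono nhdsWithin_le_nhds, self_mem_nhdsWithin] with z hz hz0
    have hz0 : z ≠ 0 := hz0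
    have gz : g z ≠ 0 := slitPlane_ne_zero hz
    have hs : (gaussianScale : ℂ) ≠ 0 := ofReal_ne_zero.mpr gaussianScale_pos.ne'
    have hh : h z ^ 4 = (g z ^ 2)⁻¹ := by
      have := cpow_mul_nat (g z) (-(1 / 2)) 4
      rw [← this, ← cpow_ofNat, ← cpow_neg]
      norm_num
    refine ⟨mul_ne_zero (mul_ne_zero hs hz0) ?_, ?_⟩
    · intro h0
      rw [h0, zero_pow four_ne_zero] at hh
      exact inv_ne_zero (pow_ne_zero 2 gz) hh.symm
    · rw [mul_pow, mul_pow, hh, gaussianScale_pow_four, gaussianB, ← gP z hz0, mul_pow, mul_inv]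
      field_simp

/-! ### Primitives on the unit disc -/

theorem one_sub_pow_mem_slitPlane {m : ℕ} (hm : m ≠ 0) {s : ℂ} (hs : s ∈ Metric.ball (0 : ℂ) 1) :
    1 - s ^ m ∈ slitPlane := by
  refine .inl ?_
  have h1 : ‖s ^ m‖ < 1 := by
    rw [norm_pow]
    exact pow_lt_one₀ (norm_nonneg _) (by simpa using hs) hm
  have h2 := (re_le_norm (s ^ m)).trans_lt h1
  simp only [sub_re, one_re]
  linarith

theorem eqOn_ball_of_hasDerivAt {f g f' : ℂ → ℂ}
    (hf : ∀ s ∈ Metric.ball (0 : ℂ) 1, HasDerivAt f (f' s) s)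
    (hg : ∀ s ∈ Metric.ball (0 : ℂ) 1, HasDerivAt g (f' s) s) (h : f 0 = g 0) :
    Set.EqOn f g (Metric.ball (0 : ℂ) 1) :=
  Metric.isOpen_ball.eqOn_of_deriv_eq (convex_ball _ _).isPreconnected
    (fun s hs => (hf s hs).differentiableAt.differentiableWithinAt)
    (fun s hs => (hg s hs).differentiableAt.differentiableWithinAt)
    (fun s hs => by rw [(hf s hs).deriv, (hg s hs).deriv]) (Metric.mem_ball_self one_pos) h

theorem eventually_eq_of_hasDerivAt_zero {f : ℂ → ℂ} {z₀ : ℂ}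
    (h : ∀ᶠ z in 𝓝 z₀, HasDerivAt f 0 z) : ∀ᶠ z in 𝓝 z₀, f z = f z₀ := by
  obtain ⟨ε, hε, hb⟩ := Metric.eventually_nhds_iff_ball.mp h
  filter_upwards [Metric.ball_mem_nhds z₀ hε] with z hz
  exact Metric.isOpen_ball.eqOn_of_deriv_eq (g := fun _ => f z₀) (convex_ball _ _).isPreconnected
    (fun s hs => (hb s hs).differentiableAt.differentiableWithinAt)
    (differentiableOn_const _)
    (fun s hs => by rw [(hb s hs).deriv, deriv_const]) (Metric.mem_ball_self hε) rfl hz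

/-- A primitive of `b (1 - s ^ m) ^ r` on the unit disc, with its symmetries. -/
theorem exists_primitive_one_sub_pow {m : ℕ} (hm : m ≠ 0) (b r : ℝ) : ∃ A : ℂ → ℂ, A 0 = 0 ∧
    (∀ s ∈ Metric.ball (0 : ℂ) 1, HasDerivAt A (b * (1 - s ^ m) ^ (r : ℂ)) s) ∧
    (∀ ζ : ℂ, ζ ^ m = 1 → ∀ s ∈ Metric.ball (0 : ℂ) 1, A (ζ * s) = ζ * A s) ∧
    (∀ s ∈ Metric.ball (0 : ℂ) 1, A ((starRingEnd ℂ) s) = (starRingEnd ℂ) (A s)) := by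
  have diff : DifferentiableOn ℂ (fun s : ℂ => b * (1 - s ^ m) ^ (r : ℂ))
      (Metric.ball (0 : ℂ) 1) := by
    intro s hs
    refine DifferentiableAt.differentiableWithinAt ?_
    have h1 : DifferentiableAt ℂ (fun s : ℂ => 1 - s ^ m) s := by fun_prop
    exact (h1.cpow_const (one_sub_pow_mem_slitPlane hm hs)).const_mul _
  obtain ⟨A, A0, hA⟩ := diff.isExactOn_ball.with_val_at 0 0
  refine ⟨A, A0, hA, ?_, ?_⟩
  · intro ζ hζ
    have hn : ‖ζ‖ = 1 := norm_eq_one_of_pow_eq_one hζ hm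
    refine eqOn_ball_of_hasDerivAt (f' := fun s => ζ * (b * (1 - s ^ m) ^ (r : ℂ)))
      (fun s hs => ?_) (fun s hs => (hA s hs).const_mul ζ) (by simp [A0])
    have hs' : ζ * s ∈ Metric.ball (0 : ℂ) 1 := by simpa [hn] using hs
    have := (hA _ hs').comp s ((hasDerivAt_id s).const_mul ζ)
    simp only [mul_pow, hζ, one_mul, mul_one] at this
    exact this.congr_deriv (mul_comm _ _)
  · intro s hs
    have key : Set.EqOn ((starRingEnd ℂ) ∘ A ∘ (starRingEnd ℂ)) A (Metric.ball (0 : ℂ) 1) := by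
      refine eqOn_ball_of_hasDerivAt (fun s hs => ?_) hA (by simp [A0])
      have hs' : (starRingEnd ℂ) s ∈ Metric.ball (0 : ℂ) 1 := by simpa using hs
      have := (hA _ hs').conj_conj
      rw [conj_conj] at this
      refine this.congr_deriv ?_
      have ne : (1 - (starRingEnd ℂ) s ^ m).arg ≠ Real.pi :=
        (mem_slitPlane_iff_arg.mp (one_sub_pow_mem_slitPlane hm hs')).1
      rw [map_mul, conj_ofReal]
      congr 1
      have := congrArg (starRingEnd ℂ) (cpow_conj _ (r : ℂ) ne)
      simpa [conj_ofReal] using this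
    have := key hs
    simp only [Function.comp_apply] at this
    rw [← this, conj_conj]

/-- Along a primitive on the unit disc, an identity for the Belyi function propagates. -/
theorem gaussianB_comp_eq_of_frequently {A a p : ℂ → ℂ}
    (hA : ∀ s ∈ Metric.ball (0 : ℂ) 1, HasDerivAt A (a s) s) (hp : Differentiable ℂ p) {s₀ : ℂ}
    (hs₀ : s₀ ∈ Metric.ball (0 : ℂ) 1) (h : ∃ᶠ s in 𝓝[≠] s₀, gaussianB (A s) = p s) :
    ∀ s ∈ Metric.ball (0 : ℂ) 1, gaussianB (A s) = p s := by
  have an : ∀ s ∈ Metric.ball (0 : ℂ) 1, AnalyticAt ℂ A s := by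
    have : DifferentiableOn ℂ A (Metric.ball 0 1) :=
      fun s hs => (hA s hs).differentiableAt.differentiableWithinAt
    exact this.analyticOnNhd Metric.isOpen_ball
  have nf : ∀ s ∈ Metric.ball (0 : ℂ) 1, MeromorphicNFAt (gaussianB ∘ A) s := fun s hs =>
    (meromorphicNFAt_gaussianB (A s)).comp_analyticAt (an s hs)
  have nf' : ∀ s, MeromorphicNFAt p s := fun s => (hp.analyticAt s).meromorphicNFAt
  intro s hs
  have := MeromorphicOn.eventuallyEq_nhdsNE_of_isPreconnected
    (fun s hs => (nf s hs).meromorphicAt) (fun s _ => (nf' s).meromorphicAt)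
    (convex_ball (0 : ℂ) 1).isPreconnected hs₀ hs h
  exact (((nf s hs).eventuallyEq_nhdsNE_iff_eventuallyEq_nhds (nf' s)).mp this).eq_of_nhds

theorem eventually_eq_one_of_pow_four_eq_one {f : ℂ → ℂ} (hf : ContinuousAt f 0) (h0 : f 0 = 1)
    (h : ∀ᶠ z in 𝓝[≠] 0, f z ^ 4 = 1) : ∀ᶠ z in 𝓝 0, f z = 1 := by
  have c : ContinuousAt (fun z => (f z + 1) * (f z ^ 2 + 1)) 0 := by fun_prop
  have ne : ∀ᶠ z in 𝓝 0, (f z + 1) * (f z ^ 2 + 1) ≠ 0 :=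
    c.eventually_ne (by rw [h0]; norm_num)
  rw [eventually_nhdsWithin_iff] at h
  filter_upwards [ne, h] with z h1 h2
  by_cases hz : z = 0
  · rw [hz, h0]
  · have h3 : (f z - 1) * ((f z + 1) * (f z ^ 2 + 1)) = 0 := by
      linear_combination h2 hz
    exact sub_eq_zero.mp ((mul_eq_zero.mp h3).resolve_right h1)

/-- The inverse of the fourth root of the Belyi function, on the unit disc. -/
theorem gaussianB_comp_primitive {A : ℂ → ℂ} (A0 : A 0 = 0)
    (hA : ∀ s ∈ Metric.ball (0 : ℂ) 1,
      HasDerivAt A (((gaussianScale⁻¹ : ℝ) : ℂ) * (1 - s ^ 4) ^ ((-(1 / 2) : ℝ) : ℂ)) s) :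
    ∀ s ∈ Metric.ball (0 : ℂ) 1, gaussianB (A s) = s ^ 4 := by
  obtain ⟨U, Ua, U0, U', hU⟩ := exists_root_gaussianB
  have hs : (gaussianScale : ℂ) ≠ 0 := ofReal_ne_zero.mpr gaussianScale_pos.ne'
  have Uball : ∀ᶠ z in 𝓝 0, U z ∈ Metric.ball (0 : ℂ) 1 :=
    Ua.continuousAt.eventually (by rw [U0]; exact Metric.ball_mem_nhds _ one_pos)
  -- f is the derivative of A ∘ U. The equation for B gives f⁴ = 1, and f(0) = 1 selects the root f
  -- = 1; hence A inverts U near 0.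
  let f : ℂ → ℂ := fun z =>
    ((gaussianScale⁻¹ : ℝ) : ℂ) * (1 - U z ^ 4) ^ ((-(1 / 2) : ℝ) : ℂ) * deriv U z
  have dAU : ∀ᶠ z in 𝓝 0, HasDerivAt (fun z => A (U z)) (f z) z := by
    filter_upwards [Uball, Ua.eventually_analyticAt] with z h1 h2
    exact (hA _ h1).comp z h2.differentiableAt.hasDerivAt
  have f0 : f 0 = 1 := by simp [f, U0, U', hs]
  have fc : ContinuousAt f 0 := by
    have c1 := Ua.continuousAt
    have c2 := Ua.deriv.continuousAt
    have c3 : ContinuousAt (fun z => (1 - U z ^ 4) ^ ((-(1 / 2) : ℝ) : ℂ)) 0 :=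
      ContinuousAt.cpow (by fun_prop) continuousAt_const (by simp [U0])
    fun_prop
  have f4 : ∀ᶠ z in 𝓝[≠] 0, f z ^ 4 = 1 := by
    filter_upwards [hU, eventually_nhdsNE_eventually_nhds_iff.mpr hU,
      Uball.filter_mono nhdsWithin_le_nhds,
      Ua.eventually_analyticAt.filter_mono nhdsWithin_le_nhds] with z h1 h2 h3 h4
    have hP : gaussianP z ≠ 0 := by
      rw [← gaussianB_ne_zero_iff, h1.2]
      exact pow_ne_zero 4 h1.1
    have d1 := h4.differentiableAt.hasDerivAt.pow 4
    have d2 := (d1.congr_of_eventuallyEq (h2.mono fun w hw => hw.2)).deriv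
    have h5 := deriv_gaussianB_pow_four hP
    have h6 : 1 - U z ^ 4 ≠ 0 := slitPlane_ne_zero (one_sub_pow_mem_slitPlane four_ne_zero h3)
    rw [d2, h1.2] at h5
    have h7 : deriv U z ^ 4 = gaussianE ^ 2 * (1 - U z ^ 4) ^ 2 := by
      have : U z ^ 12 ≠ 0 := pow_ne_zero 12 h1.1
      apply mul_left_cancel₀ this
      simp only [Nat.cast_ofNat, Nat.add_one_sub_one] at h5
      linear_combination h5 / 256
    have h8 : ((1 - U z ^ 4) ^ ((-(1 / 2) : ℝ) : ℂ)) ^ 4 = ((1 - U z ^ 4) ^ 2)⁻¹ := by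
      have e : ((-(1 / 2) : ℝ) : ℂ) * (4 : ℕ) = -2 := by norm_num
      rw [← cpow_mul_nat, e, cpow_neg, cpow_ofNat]
    simp only [f]
    rw [mul_pow, mul_pow, h7, h8, ofReal_inv, inv_pow, gaussianScale_pow_four]
    have := ofReal_gaussianE_ne_zero
    field_simp
  have f1 := eventually_eq_one_of_pow_four_eq_one fc f0 f4
  have AU : ∀ᶠ z in 𝓝 0, A (U z) = z := by
    have : ∀ᶠ z in 𝓝 0, HasDerivAt (fun z => A (U z) - z) 0 z := by
      filter_upwards [dAU, f1] with z h1 h2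
      rw [h2] at h1
      exact (h1.sub (hasDerivAt_id z)).congr_deriv (sub_self 1)
    filter_upwards [eventually_eq_of_hasDerivAt_zero this] with z hz
    rw [U0, A0, sub_zero] at hz
    exact sub_eq_zero.mp hz
  -- At s = U(z) the identity reads B(z) = U(z)⁴. Such s are nonzero and accumulate at 0, so it
  -- extends to the whole disc.
  refine gaussianB_comp_eq_of_frequently hA (by fun_prop) (Metric.mem_ball_self one_pos) ?_
  have tend : Tendsto U (𝓝[≠] 0) (𝓝[≠] 0) := by
    refine tendsto_nhdsWithin_iff.mpr ⟨?_, hU.mono fun z hz => hz.1⟩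
    have := Ua.continuousAt.tendsto
    rw [U0] at this
    exact this.mono_left nhdsWithin_le_nhds
  refine tend.frequently (Eventually.frequently ?_)
  filter_upwards [AU.filter_mono nhdsWithin_le_nhds, hU] with z h1 h2
  rw [h1, h2.2]

/-! ### Monodromy of the basic Belyi function -/

/-- B = 1 means ℘ = ±e. The fibre over e is the class of 1/2; the fibre over -e is the class of i/2,
which contains no real point. -/
theorem two_mul_sub_one_mem_of_gaussianB_eq_one {c : ℂ} (hc : (starRingEnd ℂ) c = c)
    (h : gaussianB c = 1) : 2 * c - 1 ∈ gaussianLattice := by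
  have hP : gaussianP c ≠ 0 := (gaussianB_ne_zero_iff c).mp (by rw [h]; exact one_ne_zero)
  have hc' := notMem_of_gaussianP_ne_zero hP
  have h1 : gaussianP c ^ 2 = (gaussianE : ℂ) ^ 2 := by
    rw [gaussianB, div_eq_one_iff_eq (pow_ne_zero 2 hP)] at h
    exact h.symm
  have him : c.im = 0 := conj_eq_iff_im.mp hc
  have h2 : gaussianP (Complex.I * (1 / 2)) = -gaussianE := by
    rw [gaussianP_I_mul, gaussianP_half]
  have h3 : Complex.I * (1 / 2) ∉ gaussianLattice := by
    rw [I_mul_mem_gaussianLattice]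
    exact half_notMem_gaussianLattice
  have real_notMem : ∀ z : ℂ, z.im * 2 = 1 ∨ z.im * 2 = -1 → z ∉ gaussianLattice := by
    intro z hz hmem
    obtain ⟨m, n, rfl⟩ := mem_gaussianLattice.mp hmem
    simp only [add_im, intCast_im, mul_im, intCast_re, I_im, I_re, mul_one, mul_zero, zero_add,
      add_zero] at hz
    norm_cast at hz
    omega
  rcases sq_eq_sq_iff_eq_or_eq_neg.mp h1 with h4 | h4
  · rw [← gaussianP_half] at h4
    rcases gaussianP_eq_of_ne hc' half_notMem_gaussianLattice h4 with h5 | h5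
    · have := add_mem h5 h5
      rwa [show c - 1 / 2 + (c - 1 / 2) = 2 * c - 1 by ring] at this
    · have := sub_mem (add_mem h5 h5) (add_mem one_mem_gaussianLattice one_mem_gaussianLattice)
      rwa [show c + 1 / 2 + (c + 1 / 2) - (1 + 1) = 2 * c - 1 by ring] at this
  · rw [← h2] at h4
    rcases gaussianP_eq_of_ne hc' h3 h4 with h5 | h5
    · exact absurd h5 (real_notMem _ (.inr (by simp [him])))
    · exact absurd h5 (real_notMem _ (.inl (by simp [him])))

theorem gaussianB_half : gaussianB (1 / 2) = 1 := by
  rw [gaussianB, gaussianP_half, div_self (pow_ne_zero 2 ofReal_gaussianE_ne_zero)]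

theorem gaussianB_zero : gaussianB 0 = 0 := by
  rw [gaussianB, gaussianP_of_mem (zero_mem _)]
  simp

theorem ofReal_mem_unitBall {x : ℝ} (h0 : 0 ≤ x) (h1 : x < 1) :
    (x : ℂ) ∈ Metric.ball (0 : ℂ) 1 := by
  simpa [abs_of_nonneg h0] using h1

theorem ofReal_re_of_conj_comm {F : ℂ → ℂ}
    (hF : ∀ s ∈ Metric.ball (0 : ℂ) 1, F ((starRingEnd ℂ) s) = (starRingEnd ℂ) (F s))
    {x : ℝ} (h0 : 0 ≤ x) (h1 : x < 1) : ((F x).re : ℂ) = F x := by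
  have := hF x (ofReal_mem_unitBall h0 h1)
  rw [conj_ofReal] at this
  exact conj_eq_iff_re.mp this.symm

theorem continuousOn_re_ofReal {F : ℂ → ℂ} (hF : ContinuousOn F (Metric.ball 0 1)) {x : ℝ}
    (h1 : x < 1) : ContinuousOn (fun t : ℝ => (F t).re) (Set.Icc 0 x) :=
  continuous_re.comp_continuousOn (hF.comp continuous_ofReal.continuousOn fun _ ht =>
    ofReal_mem_unitBall ht.1 (ht.2.trans_lt h1))

/-- The uniformization at a vertex maps the segment `(0, 1)` into half an edge. -/
theorem re_primitive_mem_Ioo {A : ℂ → ℂ} (A0 : A 0 = 0)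
    (hA : ∀ s ∈ Metric.ball (0 : ℂ) 1,
      HasDerivAt A (((gaussianScale⁻¹ : ℝ) : ℂ) * (1 - s ^ 4) ^ ((-(1 / 2) : ℝ) : ℂ)) s)
    (hA_conj : ∀ s ∈ Metric.ball (0 : ℂ) 1, A ((starRingEnd ℂ) s) = (starRingEnd ℂ) (A s))
    (hB : ∀ s ∈ Metric.ball (0 : ℂ) 1, gaussianB (A s) = s ^ 4)
    {s₀ : ℝ} (h0 : 0 < s₀) (h1 : s₀ < 1) : (A s₀).re ∈ Set.Ioo 0 (1 / 2 : ℝ) := by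
  have hA_cont : ContinuousOn A (Metric.ball 0 1) :=
    fun s hs => (hA s hs).continuousAt.continuousWithinAt
  have cont := continuousOn_re_ofReal hA_cont h1
  have re0 : (A ((0 : ℝ) : ℂ)).re = 0 := by simp [A0]
  constructor
  · have mono : StrictMonoOn (fun t : ℝ => (A t).re) (Set.Icc 0 s₀) := by
      refine strictMonoOn_of_deriv_pos (convex_Icc _ _) cont fun t ht => ?_
      rw [interior_Icc] at ht
      have ht1 : t < 1 := ht.2.trans h1
      have d := (hA t (ofReal_mem_unitBall ht.1.le ht1)).real_of_complex
      rw [d.deriv]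
      have hp : 0 < 1 - t ^ 4 := by
        have := pow_lt_one₀ ht.1.le ht1 four_ne_zero
        linarith
      have e : (1 - (t : ℂ) ^ 4) ^ ((-(1 / 2) : ℝ) : ℂ) =
          (((1 - t ^ 4) ^ (-(1 / 2) : ℝ) : ℝ) : ℂ) := by
        rw [ofReal_cpow hp.le]
        push_cast
        rfl
      rw [e, ← ofReal_mul, ofReal_re]
      exact mul_pos (inv_pos.mpr gaussianScale_pos) (Real.rpow_pos_of_pos hp _)
    have := mono (Set.left_mem_Icc.mpr h0.le) (Set.right_mem_Icc.mpr h0.le) h0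
    simpa only [re0] using this
  -- Reaching 1/2 would require B = 1, while B(A(t)) = t⁴ < 1 along the segment.
  · by_contra! h
    obtain ⟨t, ht, hte⟩ := intermediate_value_Icc h0.le cont ⟨by rw [re0]; norm_num, h⟩
    have ht1 : t < 1 := ht.2.trans_lt h1
    have hAt := ofReal_re_of_conj_comm hA_conj ht.1 ht1
    simp only at hte
    rw [hte] at hAt
    have := hB t (ofReal_mem_unitBall ht.1 ht1)
    rw [← hAt, show ((1 / 2 : ℝ) : ℂ) = 1 / 2 by push_cast; rfl, gaussianB_half] at this
    have h4 : t ^ 4 = 1 := by exact_mod_cast this.symm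
    exact (pow_lt_one₀ ht.1 ht1 four_ne_zero).ne h4

/-- The uniformization at an edge midpoint is centred at `1 / 2`. -/
theorem eq_half_of_gaussianB_eq_one_sub_sq {c : ℂ} {D : ℂ → ℂ} (D0 : D 0 = 0)
    (hc : (starRingEnd ℂ) c = c) (hD_cont : ContinuousOn D (Metric.ball 0 1))
    (hD_conj : ∀ s ∈ Metric.ball (0 : ℂ) 1, D ((starRingEnd ℂ) s) = (starRingEnd ℂ) (D s))
    (hBD : ∀ u ∈ Metric.ball (0 : ℂ) 1, gaussianB (c - D u) = 1 - u ^ 2)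
    {u₀ : ℝ} (h0 : 0 < u₀) (h1 : u₀ < 1) (h : (c - D u₀).re ∈ Set.Ioo 0 (1 / 2 : ℝ)) :
    c = 1 / 2 := by
  have cont : ContinuousOn (fun t : ℝ => (c - D t).re) (Set.Icc 0 u₀) :=
    continuousOn_re_ofReal (F := fun t => c - D t) (continuousOn_const.sub hD_cont) h1
  have hcre : (c.re : ℂ) = c := conj_eq_iff_re.mp hc
  have re0 : (c - D ((0 : ℝ) : ℂ)).re = c.re := by simp [D0]
  have value : ∀ t ∈ Set.Icc 0 u₀, ∀ r : ℝ, (c - D t).re = r →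
      gaussianB r = ((1 - t ^ 2 : ℝ) : ℂ) := by
    intro t ht r hr
    have ht1 : t < 1 := ht.2.trans_lt h1
    have e : (((c - D t).re : ℝ) : ℂ) = c - D t := by
      rw [sub_re, ofReal_sub, hcre, ofReal_re_of_conj_comm hD_conj ht.1 ht1]
    rw [hr] at e
    rw [e, hBD t (ofReal_mem_unitBall ht.1 ht1)]
    push_cast
    rfl
  -- As t runs from u₀ to 0, the real point c - D(t) moves from (0, 1/2) to c with B = 1 - t². If c
  -- ≥ 1/2, it meets 1/2, where B = 1 forces t = 0. If c < 1/2, it cannot meet 0, where B = 0, so 0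
  -- < c < 1/2; but B(c) = 1 puts 2c - 1 in the lattice.
  rcases le_or_gt (1 / 2) c.re with hle | hlt
  · obtain ⟨t, ht, hte⟩ := intermediate_value_Icc' h0.le cont ⟨h.2.le, by rw [re0]; exact hle⟩
    have := value t ht _ hte
    rw [show ((1 / 2 : ℝ) : ℂ) = 1 / 2 by push_cast; rfl, gaussianB_half] at this
    have h2 : 1 - t ^ 2 = 1 := by exact_mod_cast this.symm
    have ht0 : t = 0 := by
      have : t ^ 2 = 0 := by linarith
      simpa using this
    simp only [ht0] at hte
    rw [← hcre, ← re0, hte]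
    push_cast
    rfl
  · have hpos : 0 < c.re := by
      by_contra! hneg
      obtain ⟨t, ht, hte⟩ := intermediate_value_Icc h0.le cont ⟨by rw [re0]; exact hneg, h.1.le⟩
      have := value t ht _ hte
      rw [ofReal_zero, gaussianB_zero] at this
      have h2 : 1 - t ^ 2 = 0 := by exact_mod_cast this.symm
      have := pow_lt_one₀ ht.1 (ht.2.trans_lt h1) two_ne_zero
      linarith
    have hmem := two_mul_sub_one_mem_of_gaussianB_eq_one hc
      (by simpa [D0] using hBD 0 (Metric.mem_ball_self one_pos))
    obtain ⟨m, n, hmn⟩ := mem_gaussianLattice.mp hmem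
    have hre := congrArg re hmn
    simp at hre
    have h2 : (-1 : ℝ) < m := by linarith
    have h3 : (m : ℝ) < 0 := by linarith
    have h2' : (-1 : ℤ) < m := by exact_mod_cast h2
    have h3' : m < 0 := by exact_mod_cast h3
    omega

/-- The two uniformizations of `gaussianB`, at a vertex and at an edge midpoint, agree along the
edge. -/
theorem exists_gaussianB_comp_eq_one_sub_sq {A : ℂ → ℂ} (A0 : A 0 = 0)
    (hA : ∀ s ∈ Metric.ball (0 : ℂ) 1,
      HasDerivAt A (((gaussianScale⁻¹ : ℝ) : ℂ) * (1 - s ^ 4) ^ ((-(1 / 2) : ℝ) : ℂ)) s)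
    (hA_conj : ∀ s ∈ Metric.ball (0 : ℂ) 1, A ((starRingEnd ℂ) s) = (starRingEnd ℂ) (A s))
    (hB : ∀ s ∈ Metric.ball (0 : ℂ) 1, gaussianB (A s) = s ^ 4)
    {s₀ u₀ : ℝ} (hs₀ : 0 < s₀) (hu₀ : 0 < u₀) (h₀ : s₀ ^ 4 = 1 - u₀ ^ 2) :
    ∃ D : ℂ → ℂ, 1 / 2 - D u₀ = A s₀ ∧ (∀ u ∈ Metric.ball (0 : ℂ) 1, D (-u) = -D u) ∧
      ContinuousOn D (Metric.ball 0 1) ∧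
      ∀ u ∈ Metric.ball (0 : ℂ) 1, gaussianB (1 / 2 - D u) = 1 - u ^ 2 := by
  -- The substitution s = (1 - u²)^(1/4) turns (1 - s⁴)^(-1/2) ds into -(1/2)(1 - u²)^(-3/4) du,
  -- which explains the factor 1/2 and the exponent; A(s(u)) + D(u) is then locally constant.
  obtain ⟨D, D0, hD, hD_mul, hD_conj⟩ :=
    exists_primitive_one_sub_pow two_ne_zero (gaussianScale⁻¹ / 2) (-(3 / 4))
  have hs1 : s₀ < 1 := by
    by_contra! h
    have := one_le_pow₀ h (n := 4)
    nlinarith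
  have hu1 : u₀ < 1 := by
    by_contra! h
    have := one_le_pow₀ h (n := 2)
    have := pow_pos hs₀ 4
    nlinarith
  have hs₀b := ofReal_mem_unitBall hs₀.le hs1
  have hu₀b := ofReal_mem_unitBall hu₀.le hu1
  let s : ℂ → ℂ := fun u => (1 - u ^ 2) ^ (1 / 4 : ℂ)
  have s_pow : ∀ u, s u ^ 4 = 1 - u ^ 2 := by
    intro u
    simp only [s]
    rw [← cpow_mul_nat]
    norm_num
  have s_u₀ : s u₀ = s₀ := by
    have e : (1 - (u₀ : ℂ) ^ 2) = ((s₀ ^ 4 : ℝ) : ℂ) := by rw [h₀]; push_cast; ring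
    have e2 : (1 / 4 : ℂ) = ((1 / 4 : ℝ) : ℂ) := by push_cast; ring
    simp only [s]
    rw [e, e2, ← ofReal_cpow (by positivity)]
    congr 1
    rw [← Real.rpow_natCast, ← Real.rpow_mul hs₀.le]
    norm_num
  have ds : ∀ u ∈ Metric.ball (0 : ℂ) 1,
      HasDerivAt s (-(u / 2) * (1 - u ^ 2) ^ ((-(3 / 4) : ℝ) : ℂ)) u := by
    intro u hu
    have d1 : HasDerivAt (fun u : ℂ => 1 - u ^ 2) (-(2 * u)) u := by
      simpa using (hasDerivAt_pow 2 u).const_sub 1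
    have := d1.cpow_const (c := 1 / 4) (one_sub_pow_mem_slitPlane two_ne_zero hu)
    refine this.congr_deriv ?_
    rw [show (1 / 4 - 1 : ℂ) = ((-(3 / 4) : ℝ) : ℂ) by push_cast; norm_num]
    ring
  set c : ℂ := A s₀ + D u₀ with hc
  have near : ∀ᶠ u in 𝓝 (u₀ : ℂ), A (s u) + D u = c := by
    have : ∀ᶠ u in 𝓝 (u₀ : ℂ), HasDerivAt (fun u => A (s u) + D u) 0 u := by
      have e1 : ∀ᶠ u in 𝓝 (u₀ : ℂ), u ∈ Metric.ball (0 : ℂ) 1 :=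
        Metric.isOpen_ball.mem_nhds hu₀b
      have e2 : ∀ᶠ u in 𝓝 (u₀ : ℂ), s u ∈ Metric.ball (0 : ℂ) 1 :=
        (ds _ hu₀b).continuousAt.eventually
          (by rw [s_u₀]; exact Metric.isOpen_ball.mem_nhds hs₀b)
      -- A positive real part is needed for the principal root of u² to be u.
      have e3 : ∀ᶠ u : ℂ in 𝓝 (u₀ : ℂ), 0 < u.re :=
        continuous_re.continuousAt.eventually (by simpa using! lt_mem_nhds hu₀)
      filter_upwards [e1, e2, e3] with u h1 h2 h3
      have hu : u ≠ 0 := by rintro rfl; simp at h3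
      refine (((hA _ h2).comp u (ds u h1)).add (hD u h1)).congr_deriv ?_
      rw [s_pow, sub_sub_cancel, show ((-(1 / 2) : ℝ) : ℂ) = -2⁻¹ by push_cast; norm_num, cpow_neg,
        sq_cpow_two_inv h3]
      push_cast
      field_simp
      ring
    filter_upwards [eventually_eq_of_hasDerivAt_zero this] with u hu
    rw [hu, s_u₀]
  have hBD : ∀ u ∈ Metric.ball (0 : ℂ) 1, gaussianB (c - D u) = 1 - u ^ 2 := by
    refine gaussianB_comp_eq_of_frequently (fun u hu => (hD u hu).const_sub c) (by fun_prop) hu₀b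
      (Eventually.frequently ?_)
    have e2 : ∀ᶠ u in 𝓝 (u₀ : ℂ), s u ∈ Metric.ball (0 : ℂ) 1 :=
      (ds _ hu₀b).continuousAt.eventually
        (by rw [s_u₀]; exact Metric.isOpen_ball.mem_nhds hs₀b)
    filter_upwards [near.filter_mono nhdsWithin_le_nhds, e2.filter_mono nhdsWithin_le_nhds]
      with u h1 h2
    rw [← h1, add_sub_cancel_right, hB _ h2, s_pow]
  have hD_cont : ContinuousOn D (Metric.ball 0 1) :=
    fun u hu => (hD u hu).continuousAt.continuousWithinAt
  have hcD : c - D u₀ = A s₀ := by rw [hc, add_sub_cancel_right]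
  have c_half : c = 1 / 2 := by
    refine eq_half_of_gaussianB_eq_one_sub_sq D0 ?_ hD_cont hD_conj hBD hu₀ hu1 ?_
    · rw [hc, map_add, ← hA_conj _ hs₀b, ← hD_conj _ hu₀b, conj_ofReal, conj_ofReal]
    · rw [hcD]
      exact re_primitive_mem_Ioo A0 hA hA_conj hB hs₀ hs1
  rw [c_half] at hcD hBD
  exact ⟨D, hcD, fun u hu => by simpa using hD_mul (-1) (by norm_num) u hu, hD_cont, hBD⟩

/-- A point of the fibre of `gaussianB` over `1/2`, with the lifts of the loops around `0` and
around `1`. -/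
theorem exists_gaussianB_monodromy : ∃ t₀ : ℂ, gaussianB t₀ = 1 / 2 ∧
    (∃ γ : I → ℂ, Continuous γ ∧ γ 0 = t₀ ∧ γ 1 = Complex.I * t₀ ∧
      ∀ t, gaussianB (γ t) = loopZero t) ∧
    (∃ γ : I → ℂ, Continuous γ ∧ γ 0 = t₀ ∧ γ 1 = 1 - t₀ ∧
      ∀ t, gaussianB (γ t) = loopOne t) := by
  obtain ⟨A, A0, hA, hA_mul, hA_conj⟩ :=
    exists_primitive_one_sub_pow four_ne_zero (gaussianScale⁻¹) (-(1 / 2))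
  have hB := gaussianB_comp_primitive A0 hA
  have hA_cont : ContinuousOn A (Metric.ball 0 1) :=
    fun s hs => (hA s hs).continuousAt.continuousWithinAt
  set u₀ : ℝ := √(1 / 2) with hu₀
  set s₀ : ℝ := √u₀ with hs₀
  have u_pos : 0 < u₀ := by positivity
  have s_pos : 0 < s₀ := Real.sqrt_pos.mpr u_pos
  have u_sq : u₀ ^ 2 = 1 / 2 := Real.sq_sqrt (by norm_num)
  have s_pow : s₀ ^ 4 = 1 / 2 := by
    rw [show 4 = 2 * 2 by rfl, pow_mul, hs₀, Real.sq_sqrt u_pos.le, u_sq]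
  obtain ⟨D, hcD, D_neg, D_cont, hBD⟩ := exists_gaussianB_comp_eq_one_sub_sq A0 hA hA_conj hB
    s_pos u_pos (by rw [s_pow, u_sq]; norm_num)
  have s_lt : s₀ < 1 := by
    by_contra! h
    have := one_le_pow₀ h (n := 4)
    rw [s_pow] at this
    norm_num at this
  have u_lt : u₀ < 1 := by
    by_contra! h
    have := one_le_pow₀ h (n := 2)
    rw [u_sq] at this
    norm_num at this
  have circ : ∀ r : ℝ, 0 < r → r < 1 → ∀ x : ℝ,
      (r : ℂ) * cexp (x * Complex.I) ∈ Metric.ball (0 : ℂ) 1 := by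
    intro r h0 h1 x
    simpa [norm_exp_ofReal_mul_I, abs_of_pos h0] using h1
  have s_mem : (s₀ : ℂ) ∈ Metric.ball (0 : ℂ) 1 := by simpa using circ s₀ s_pos s_lt 0
  have u_mem : (u₀ : ℂ) ∈ Metric.ball (0 : ℂ) 1 := by simpa using circ u₀ u_pos u_lt 0
  have s_powC : (s₀ : ℂ) ^ 4 = 1 / 2 := by
    have := congrArg ofReal s_pow
    push_cast at this
    exact this
  have u_sqC : (u₀ : ℂ) ^ 2 = 1 / 2 := by
    have := congrArg ofReal u_sq
    push_cast at this
    exact this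
  -- Since s₀⁴ = u₀² = 1/2, a quarter turn of s winds s⁴ once around 0, and a half turn of u winds 1
  -- - u² once around 1. The endpoints follow from A(is) = iA(s) and from D being odd.
  refine ⟨A s₀, by rw [hB _ s_mem, s_powC], ⟨fun t => A (s₀ * cexp ((Real.pi / 2 * t : ℝ) *
      Complex.I)), ?_, ?_, ?_, fun t => ?_⟩, ⟨fun t => 1 / 2 - D (u₀ * cexp ((Real.pi * t : ℝ) *
      Complex.I)), ?_, ?_, ?_, fun t => ?_⟩⟩
  · exact hA_cont.comp_continuous (by fun_prop) fun t => circ _ s_pos s_lt _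
  · simp
  · have e : cexp ((Real.pi / 2 * (1 : I) : ℝ) * Complex.I) = Complex.I := by
      simp [exp_pi_div_two_mul_I]
    simp only [e]
    rw [mul_comm, hA_mul _ I_pow_four _ s_mem]
  · rw [hB _ (circ _ s_pos s_lt _), mul_pow, s_powC, ← exp_nat_mul, loopZero]
    congr 2
    push_cast
    ring
  · exact continuous_const.sub
      (D_cont.comp_continuous (by fun_prop) fun t => circ _ u_pos u_lt _)
  · simpa using hcD
  · have e : cexp ((Real.pi * (1 : I) : ℝ) * Complex.I) = -1 := by
      simp [exp_pi_mul_I]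
    simp only [e]
    rw [mul_neg_one, D_neg _ u_mem, ← hcD]
    ring
  · rw [hBD _ (circ _ u_pos u_lt _), mul_pow, u_sqC, ← exp_nat_mul, loopOne]
    congr 3
    push_cast
    ring

/-! ### The square grid as a dessin -/

theorem mem_gaussianLattice_iff_toComplex {z : ℂ} :
    z ∈ gaussianLattice ↔ ∃ P : GaussianInt, GaussianInt.toComplex P = z := by
  rw [mem_gaussianLattice]
  constructor
  · rintro ⟨m, n, rfl⟩
    exact ⟨⟨m, n⟩, GaussianInt.toComplex_def _⟩
  · rintro ⟨P, rfl⟩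
    exact ⟨P.re, P.im, (GaussianInt.toComplex_def P).symm⟩

theorem toComplex_mem_gaussianLattice (P : GaussianInt) :
    GaussianInt.toComplex P ∈ gaussianLattice :=
  mem_gaussianLattice_iff_toComplex.mpr ⟨P, rfl⟩

theorem natCast_mul_mem_gaussianLattice (k : ℕ) {z : ℂ} (hz : z ∈ gaussianLattice) :
    (k : ℂ) * z ∈ gaussianLattice := by
  simpa using gaussianLattice.smul_mem (k : ℤ) hz

theorem toComplex_unit_cases (d : GaussianIntˣ) :
    GaussianInt.toComplex d = 1 ∨ GaussianInt.toComplex d = Complex.I ∨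
      GaussianInt.toComplex d = -1 ∨ GaussianInt.toComplex d = -Complex.I := by
  rcases gaussianUnit_cases d with h | h | h | h <;> simp [h, GaussianInt.toComplex_def]

theorem toComplex_gaussianI : GaussianInt.toComplex (gaussianI : GaussianInt) = Complex.I := by
  simp [gaussianI, GaussianInt.toComplex_def]

theorem gaussianB_unit_mul (d : GaussianIntˣ) (z : ℂ) :
    gaussianB (GaussianInt.toComplex d * z) = gaussianB z := by
  have h1 : ∀ w, gaussianB (-w) = gaussianB w := fun w => by
    rw [gaussianB, gaussianP_neg, gaussianB]
  rcases toComplex_unit_cases d with h | h | h | h <;>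
    simp [h, h1, gaussianB_I_mul]

theorem mk_eq_mk_iff_toComplex_sub_div_mem {k : ℕ} (hk : k ≠ 0) (P Q : GaussianInt) :
    (Ideal.Quotient.mk (Ideal.span {(k : GaussianInt)}) P = Ideal.Quotient.mk _ Q) ↔
      (GaussianInt.toComplex P - GaussianInt.toComplex Q) / k ∈ gaussianLattice := by
  have hk' : (k : ℂ) ≠ 0 := Nat.cast_ne_zero.mpr hk
  rw [Ideal.Quotient.eq, Ideal.mem_span_singleton, mem_gaussianLattice_iff_toComplex]
  refine exists_congr fun R => ?_
  rw [eq_div_iff hk', ← GaussianInt.toComplex_sub, ← map_natCast GaussianInt.toComplex,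
    ← map_mul, GaussianInt.toComplex_inj, mul_comm R, eq_comm]

/-- A nontrivial rotation fixing t modulo the lattice is ±i, which gives ℘(t) = -℘(t) = 0, or -1,
which gives ℘'(t) = 0 and so ℘(t)² = e², that is B(t) = 1. -/
theorem unit_eq_of_sub_mul_mem {t : ℂ} (ht : gaussianB t ≠ 0) (ht' : gaussianB t ≠ 1)
    {c d : GaussianIntˣ}
    (h : (GaussianInt.toComplex c - GaussianInt.toComplex d) * t ∈ gaussianLattice) : c = d := by
  have hP : gaussianP t ≠ 0 := (gaussianB_ne_zero_iff t).mp ht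
  have htm := notMem_of_gaussianP_ne_zero hP
  have hP2 : gaussianP t ^ 2 - (gaussianE : ℂ) ^ 2 ≠ 0 := by
    intro h0
    refine ht' ?_
    rw [gaussianB, ← sub_eq_zero.mp h0, div_self (pow_ne_zero 2 hP)]
  have hmul : ∀ {z : ℂ} (R : GaussianInt), z ∈ gaussianLattice →
      GaussianInt.toComplex R * z ∈ gaussianLattice := by
    intro z R hz
    obtain ⟨Q, rfl⟩ := mem_gaussianLattice_iff_toComplex.mp hz
    rw [← map_mul]
    exact toComplex_mem_gaussianLattice _
  have h2 : (GaussianInt.toComplex ((d⁻¹ * c : GaussianIntˣ) : GaussianInt) - 1) * t ∈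
      gaussianLattice := by
    have := hmul (d⁻¹ : GaussianIntˣ) h
    rw [← mul_assoc, mul_sub, ← map_mul, ← map_mul, ← Units.val_mul, ← Units.val_mul,
      inv_mul_cancel, Units.val_one, map_one] at this
    exact this
  have key : ∀ w : ℂ, gaussianP (w * t) = -gaussianP t → (w - 1) * t ∉ gaussianLattice := by
    intro w hw hmem
    have h3 := gaussianP_add (z := t) hmem
    rw [show t + (w - 1) * t = w * t by ring, hw] at h3
    exact hP (self_eq_neg.mp h3.symm)
  rcases toComplex_unit_cases (d⁻¹ * c) with h3 | h3 | h3 | h3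
  · rw [← map_one GaussianInt.toComplex, GaussianInt.toComplex_inj] at h3
    exact (inv_mul_eq_one.mp (Units.ext h3)).symm
  · rw [h3] at h2
    exact absurd h2 (key _ (gaussianP_I_mul t))
  · rw [h3] at h2
    have h4 : 2 * t ∈ gaussianLattice := by
      have := neg_mem h2
      rwa [show -((-1 - 1) * t) = 2 * t by ring] at this
    have h5 : gaussianP' t = 0 := gaussianPeriods.derivWeierstrassP_eq_zero_of_two_mul h4
    have h6 := gaussianP'_sq htm
    rw [h5, zero_pow two_ne_zero, eq_comm] at h6
    exact absurd h6 (mul_ne_zero (mul_ne_zero (by norm_num) hP) hP2)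
  · rw [h3] at h2
    exact absurd h2 (key _ (by rw [neg_mul, gaussianP_neg, gaussianP_I_mul]))

/-- Equal B means ℘(z) = ±℘(t). The fibres of ℘ are orbits of ±1, and multiplication by i accounts
for the other sign. -/
theorem exists_unit_sub_mul_mem {z t : ℂ} (ht : gaussianB t ≠ 0) (h : gaussianB z = gaussianB t) :
    ∃ d : GaussianIntˣ, z - GaussianInt.toComplex d * t ∈ gaussianLattice := by
  have hPt : gaussianP t ≠ 0 := (gaussianB_ne_zero_iff t).mp ht
  have hPz : gaussianP z ≠ 0 := (gaussianB_ne_zero_iff z).mp (by rwa [h])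
  have htm := notMem_of_gaussianP_ne_zero hPt
  have hzm := notMem_of_gaussianP_ne_zero hPz
  have h2 : gaussianP z ^ 2 = gaussianP t ^ 2 := by
    rw [gaussianB, gaussianB, div_eq_div_iff (pow_ne_zero 2 hPz) (pow_ne_zero 2 hPt)] at h
    exact (mul_left_cancel₀ (pow_ne_zero 2 ofReal_gaussianE_ne_zero) h).symm
  have hneg : ∀ w ∉ gaussianLattice, gaussianP z = gaussianP w →
      z - w ∈ gaussianLattice ∨ z - -w ∈ gaussianLattice := by
    intro w hw e
    rw [sub_neg_eq_add]
    exact gaussianP_eq_of_ne hzm hw e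
  rcases sq_eq_sq_iff_eq_or_eq_neg.mp h2 with h3 | h3
  · rcases hneg t htm h3 with h4 | h4
    · exact ⟨1, by simpa using h4⟩
    · exact ⟨-1, by simpa using h4⟩
  · rw [← gaussianP_I_mul] at h3
    rcases hneg _ (fun h => htm (I_mul_mem_gaussianLattice.mp h)) h3 with h4 | h4
    · exact ⟨gaussianI, by rwa [toComplex_gaussianI]⟩
    · exact ⟨-gaussianI, by rwa [Units.val_neg, map_neg, toComplex_gaussianI, neg_mul]⟩

/-- The Belyi function on `ℂ/⟨1, i⟩` whose dessin is the `k × k` square grid. -/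
noncomputable def gridBelyi (k : ℕ) : ℂ ⧸ gaussianLattice → ℂ :=
  Quotient.lift (fun z => gaussianB (k * z)) fun z w h => gaussianB_eq_of_sub_mem (by
    rw [← mul_sub]
    exact natCast_mul_mem_gaussianLattice k ((Submodule.quotientRel_def _).mp h))

theorem gridBelyi_mk (k : ℕ) (z : ℂ) :
    gridBelyi k (Submodule.Quotient.mk z) = gaussianB (k * z) := rfl

theorem isBelyiFunction_gridBelyi {k : ℕ} (hk : k ≠ 0) :
    IsBelyiFunction gaussianLattice (gridBelyi k) where
  meromorphic z _ :=
    (meromorphicNFAt_gaussianB (k * z)).comp_analyticAt (g := fun z : ℂ => (k : ℂ) * z)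
      (by fun_prop)
  nonconstant := by
    have hk' : (k : ℂ) ≠ 0 := Nat.cast_ne_zero.mpr hk
    refine ⟨Submodule.Quotient.mk 0, Submodule.Quotient.mk (1 / 2 / k), ?_⟩
    rw [gridBelyi_mk, gridBelyi_mk, mul_zero, gaussianB_zero, mul_div_cancel₀ _ hk',
      gaussianB_half]
    exact zero_ne_one
  unramified z h0 h1 := by
    simp only [gridBelyi_mk] at h0 h1 ⊢
    have hP : gaussianP (k * z) ≠ 0 := (gaussianB_ne_zero_iff _).mp h0
    have d := (hasDerivAt_gaussianB hP).differentiableAt.hasDerivAt.comp z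
      ((hasDerivAt_id z).const_mul (k : ℂ))
    have e : deriv (fun w : ℂ => gaussianB (k * w)) z = deriv gaussianB (k * z) * (k * 1) := d.deriv
    rw [e, mul_one]
    refine mul_ne_zero (fun h => ?_) (Nat.cast_ne_zero.mpr hk)
    have h4 := deriv_gaussianB_pow_four hP
    rw [h, zero_pow four_ne_zero, eq_comm] at h4
    have h5 : (1 - gaussianB (k * z)) ^ 2 ≠ 0 := pow_ne_zero 2 (sub_ne_zero.mpr (Ne.symm h1))
    exact mul_ne_zero (mul_ne_zero (mul_ne_zero (by norm_num)
      (pow_ne_zero 2 ofReal_gaussianE_ne_zero)) (pow_ne_zero 3 h0)) h5 h4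

/-- The two lifts at t₀ are transported to every flag by z ↦ (P + dz)/k, which carries B to the
Belyi function. The endpoint i t₀ gives the flag (P, id), and 1 - t₀ gives P + d - d t₀, the flag (P
+ d, -d): these are the grid's `rhoV` and `rhoE`. -/
theorem isDessinOf_gridBelyi {k : ℕ} (hk : k ≠ 0) : (squareGrid k).IsDessinOf (gridBelyi k) := by
  have hk' : (k : ℂ) ≠ 0 := Nat.cast_ne_zero.mpr hk
  obtain ⟨t₀, ht₀, ⟨γ₀, γ₀_cont, γ₀_zero, γ₀_one, hγ₀⟩, ⟨γ₁, γ₁_cont, γ₁_zero, γ₁_one, hγ₁⟩⟩ :=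
    exists_gaussianB_monodromy
  let point (P : GaussianInt) (d : GaussianIntˣ) (t : ℂ) : ℂ ⧸ gaussianLattice :=
    Submodule.Quotient.mk ((GaussianInt.toComplex P + GaussianInt.toComplex d * t) / k)
  have f_point : ∀ P d t, gridBelyi k (point P d t) = gaussianB t := by
    intro P d t
    rw [gridBelyi_mk, mul_div_cancel₀ _ hk', add_comm,
      gaussianB_add (toComplex_mem_gaussianLattice P), gaussianB_unit_mul]
  have point_cont : ∀ P d, Continuous (point P d) := by
    intro P d
    refine continuous_quot_mk.comp ?_
    fun_prop
  have point_eq : ∀ P Q d t, point P d t = point Q d t ↔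
      (Ideal.Quotient.mk (Ideal.span {(k : GaussianInt)}) P = Ideal.Quotient.mk _ Q) := by
    intro P Q d t
    rw [mk_eq_mk_iff_toComplex_sub_div_mem hk, Submodule.Quotient.eq, ← sub_div,
      add_sub_add_right_eq_sub]
  let φ₀ : (squareGrid k).Flag → {P : ℂ ⧸ gaussianLattice // gridBelyi k P = 1 / 2} :=
    fun a => ⟨point (Quotient.out a.1) a.2 t₀, by rw [f_point, ht₀]⟩
  have φ₀_mk : ∀ P d, (φ₀ (Ideal.Quotient.mk _ P, d) : ℂ ⧸ gaussianLattice) = point P d t₀ := by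
    intro P d
    exact (point_eq _ _ _ _).mpr (Quotient.out_eq _)
  have bij : Function.Bijective φ₀ := by
    constructor
    · intro a b hab
      obtain ⟨P, c, rfl⟩ := gridFlag_surj a
      obtain ⟨Q, d, rfl⟩ := gridFlag_surj b
      have h1 : point P c t₀ = point Q d t₀ := by
        rw [← φ₀_mk, ← φ₀_mk, hab]
      have h2 := natCast_mul_mem_gaussianLattice k ((Submodule.Quotient.eq _).mp h1)
      rw [← sub_div, mul_div_cancel₀ _ hk'] at h2
      have h3 : (GaussianInt.toComplex c - GaussianInt.toComplex d) * t₀ ∈ gaussianLattice := by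
        have := add_mem h2 (sub_mem (toComplex_mem_gaussianLattice Q)
          (toComplex_mem_gaussianLattice P))
        convert this using 1
        ring
      obtain rfl := unit_eq_of_sub_mul_mem (by rw [ht₀]; norm_num) (by rw [ht₀]; norm_num) h3
      exact Prod.ext ((point_eq _ _ _ _).mp h1) rfl
    · rintro ⟨p, hp⟩
      obtain ⟨z, rfl⟩ := Submodule.Quotient.mk_surjective _ p
      rw [gridBelyi_mk, ← ht₀] at hp
      obtain ⟨d, hd⟩ := exists_unit_sub_mul_mem (by rw [ht₀]; norm_num) hp
      obtain ⟨P, hP⟩ := mem_gaussianLattice_iff_toComplex.mp hd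
      refine ⟨(Ideal.Quotient.mk _ P, d), Subtype.ext ?_⟩
      rw [φ₀_mk]
      simp only [point, hP, sub_add_cancel]
      rw [mul_div_cancel_left₀ _ hk']
  refine ⟨Equiv.ofBijective φ₀ bij, fun a => ?_, fun a => ?_⟩
  · obtain ⟨P, d, rfl⟩ := gridFlag_surj a
    refine ⟨⟨⟨fun t => point P d (γ₀ t), (point_cont P d).comp γ₀_cont⟩, ?_, ?_⟩, fun t => ?_⟩
    · simp only [γ₀_zero]
      exact (φ₀_mk P d).symm
    · refine Eq.trans ?_ (φ₀_mk P (gaussianI * d)).symm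
      simp only [γ₀_one, point]
      rw [Units.val_mul, map_mul, toComplex_gaussianI]
      congr 2
      ring
    · exact (f_point P d _).trans (hγ₀ t)
  · obtain ⟨P, d, rfl⟩ := gridFlag_surj a
    refine ⟨⟨⟨fun t => point P d (γ₁ t), (point_cont P d).comp γ₁_cont⟩, ?_, ?_⟩, fun t => ?_⟩
    · simp only [γ₁_zero]
      exact (φ₀_mk P d).symm
    · refine Eq.trans ?_ (φ₀_mk (P + d) (-d)).symm
      simp only [γ₁_one, point]
      rw [Units.val_neg, map_neg, map_add]
      congr 2
      ring
    · exact (f_point P d _).trans (hγ₁ t)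

/-- Being the dessin of a Belyi function is invariant under isomorphism of oriented maps. -/
theorem OrientedMap.Iso.isDessinOf {M N : OrientedMap} (i : M.Iso N) {Λ : Submodule ℤ ℂ}
    {f : ℂ ⧸ Λ → ℂ} (h : N.IsDessinOf f) : M.IsDessinOf f := by
  obtain ⟨φ, h0, h1⟩ := h
  refine ⟨i.toEquiv.trans φ, fun d => ?_, fun d => ?_⟩
  · obtain ⟨γ, hγ⟩ := h0 (i.toEquiv d)
    exact ⟨γ.cast rfl (by rw [Equiv.trans_apply, i.map_rhoV]), hγ⟩
  · obtain ⟨γ, hγ⟩ := h1 (i.toEquiv d)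
    exact ⟨γ.cast rfl (by rw [Equiv.trans_apply, i.map_rhoE]), hγ⟩

end GaussianLattice

theorem mainTheorem2 (n : ℕ) (hn : 3 ≤ n) :
    Nonempty ((squareTilingMap n).Iso (squareGrid (if Even n then n / 2 else n))) ∧
    (∃ f : ℂ ⧸ gaussianLattice → ℂ,
      IsBelyiFunction gaussianLattice f ∧ (squareTilingMap n).IsDessinOf f) ∧
    IsComplexTorus curveE gaussianLattice ∧
    curveE.j = 1728 := by
  have hk : gridSize n ≠ 0 := by
    rw [gridSize]
    split_ifs <;> omega
  obtain ⟨i⟩ := nonempty_squareTilingMap_iso hn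
  exact ⟨⟨i⟩, ⟨gridBelyi (gridSize n), isBelyiFunction_gridBelyi hk,
    i.isDessinOf (isDessinOf_gridBelyi hk)⟩, isComplexTorus_curveE, curveE_j⟩
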